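/- \textbf{Conventions.} A Stone space is a compact, Hausdorff, totally disconnected topological space. For a Boolean algebra $B$, let $E(B)$ be its Stone space: the set of ultrafilters on $B$, with the topology generated by the sets $U_b=\{\omega : b\in\omega\}$, $b\in B$. A Stone space $E$ has the Boolean algebra $\Omega(E)$ of clopen subsets; $E$ is second countable if and only if $\Omega(E)$ is countable. The group $\mathrm{Homeo}(E)$ carries the compact-open topology. The automorphism group of a Boolean algebra or of a graph carries the permutation topology, in which the pointwise stabilizers of finite sets of elements (respectively vertices) form a neighbourhood basis of the identity. A \emph{cut} in $B$ is an unordered pair $\{a,\lnot a\}$ with $a\in B$. It is \emph{non-peripheral} if neither $a$ nor $\lnot a$ is $0$ or an atom. Two cuts $\{a,\lnot a\}$ and $\{b,\lnot b\}$ \emph{cross} if all four elements $a\wedge b$, $a\wedge\lnot b$, $\lnot a\wedge b$, $\lnot a\wedge\lnot b$ are nonzero; otherwise they are \emph{compatible}. The \emph{complex of cuts} $\mathscr{C}(B)$ is the simple graph whose vertices are the non-peripheral cuts, with an edge between two distinct cuts whenever they are compatible. For a Stone space $E$ put $\mathscr{C}(E)=\mathscr{C}(\Omega(E))$; thus a vertex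 is a partition $E=U\sqcup V$ into two clopen sets with at least two points each, and two cuts $U\sqcup V$, $U'\sqcup V'$ cross if $U\cap U'$, $U\cap V'$, $V\cap U'$, $V\cap V'$ are all nonempty. \textbf{Theorem.} (1) Let $E$ be a second countable Stone space with at least five points. Then the natural maps \[ \mathrm{Homeo}(E)\to \mathrm{Aut}(\Omega(E)),\ f\mapsto (U\mapsto f(U)), \qquad \mathrm{Homeo}(E)\to \mathrm{Aut}(\mathscr{C}(E)),\ f\mapsto (U\sqcup V\mapsto f(U)\sqcup f(V)), \] are isomorphisms of topological groups. Moreover the graph $\mathscr{C}(E)$ is connected; if $E$ is finite, then $\mathscr{C}(E)$ is finite of diameter at most four; if $E$ is infinite, then $\mathscr{C}(E)$ has a countably infinite vertex set and diameter two. (2) Let $B$ be a countable Boolean algebra such that $E(B)$ has at least five points. Then the natural maps \[ \mathrm{Aut}(B)\to \mathrm{Homeo}(E(B)),\ \varphi\mapsto(\omega\mapsto\varphi(\omega)), \qquad \mathrm{Aut}(B)\to \mathrm{Aut}(\mathscr{C}(B)),\ \varphi\mapsto (\{a,\lnot a\}\mapsto\{\varphi(a),\lnot\varphi(a)\}), \]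 are isomorphisms of topological groups. -/

import Mathlib

open TopologicalSpace

/-! ### Topologies on automorphism groups -/

/-- The permutation topology on the automorphism group of a relational structure `(α, r)`:
the topology of pointwise convergence with `α` discrete.  It applies to `B ≃o B` and, for a
simple graph `G`, to `G ≃g G`. -/
instance permutationTopology {α : Type*} {r : α → α → Prop} : TopologicalSpace (r ≃r r) :=
  TopologicalSpace.induced (fun (φ : r ≃r r) (x : α) => φ x)
    (@Pi.topologicalSpace α (fun _ => α) (fun _ => ⊥))

theorem permutationTopology_continuous_iff {α X : Type*} [TopologicalSpace X]
    {r : α → α → Prop} (f : X → (r ≃r r)) :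
    Continuous f ↔ ∀ x y : α, IsOpen {t : X | f t x = y} := by
  let _ : TopologicalSpace α := ⊥
  have : DiscreteTopology α := ⟨rfl⟩
  rw [continuous_induced_rng, continuous_pi_iff]
  refine forall_congr' fun x => ?_
  rw [continuous_discrete_rng]
  rfl

theorem permutationTopology_isOpen {α : Type*} {r : α → α → Prop} (x y : α) :
    IsOpen {φ : r ≃r r | φ x = y} :=
  (permutationTopology_continuous_iff (fun φ : r ≃r r => φ)).1 continuous_id x y

/-- With the permutation topology, automorphism groups are topological groups. -/
instance permutationTopology_isTopologicalGroup {α : Type*} {r : α → α → Prop} :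
    IsTopologicalGroup (r ≃r r) where
  continuous_mul := by
    rw [permutationTopology_continuous_iff]
    intro x y
    have h : {t : (r ≃r r) × (r ≃r r) | (t.1 * t.2) x = y} =
        ⋃ z : α, {φ : r ≃r r | φ z = y} ×ˢ {φ : r ≃r r | φ x = z} := by
      ext ⟨φ, ψ⟩
      simp [RelIso.mul_apply]
    rw [h]
    exact isOpen_iUnion fun z =>
      (permutationTopology_isOpen z y).prod (permutationTopology_isOpen x z)
  continuous_inv := by
    rw [permutationTopology_continuous_iff]
    intro x y
    have h : {φ : r ≃r r | φ⁻¹ x = y} = {φ : r ≃r r | φ y = x} := by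
      ext φ
      constructor
      · rintro rfl; exact φ.apply_inv_self x
      · rintro rfl; exact φ.inv_apply_self y
    rw [h]
    exact permutationTopology_isOpen y x

/-- Neighbourhoods of the identity in the permutation topology are the sets that contain the
pointwise stabilizer of a finite set. -/
theorem mem_nhds_one_iff_stabilizer {α : Type*} {r : α → α → Prop} (s : Set (r ≃r r)) :
    s ∈ nhds (1 : r ≃r r) ↔ ∃ F : Finset α, {φ : r ≃r r | ∀ x ∈ F, φ x = x} ⊆ s := by
  let _ : TopologicalSpace α := ⊥
  have : DiscreteTopology α := ⟨rfl⟩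
  constructor
  · intro hs
    rw [nhds_induced, Filter.mem_comap] at hs
    obtain ⟨t, ht, hts⟩ := hs
    rw [nhds_pi, Filter.mem_pi] at ht
    obtain ⟨I, hI, u, hu, hut⟩ := ht
    refine ⟨hI.toFinset, fun φ hφ => hts (hut fun i hi => ?_)⟩
    have h1 : φ i = i := hφ i (by simpa using hi)
    have h2 := mem_of_mem_nhds (hu i)
    change φ i ∈ u i
    rw [h1]
    exact h2
  · rintro ⟨F, hF⟩
    refine Filter.mem_of_superset ?_ hF
    have h : {φ : r ≃r r | ∀ x ∈ F, φ x = x} = ⋂ x ∈ F, {φ : r ≃r r | φ x = x} := by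
      ext φ; simp
    rw [h]
    exact (isOpen_biInter_finset fun x _ => permutationTopology_isOpen x x).mem_nhds
      (by simp)

/-- The compact-open topology on the group of homeomorphisms of a space. -/
instance homeoCompactOpen {E : Type*} [TopologicalSpace E] : TopologicalSpace (E ≃ₜ E) :=
  TopologicalSpace.induced (fun f : E ≃ₜ E => (⟨f, f.continuous⟩ : C(E, E))) inferInstance

/-! ### The Boolean algebra of clopen sets and the space of ultrafilters -/

/-- The image of a clopen set under a homeomorphism. -/
def imageClopen {E : Type*} [TopologicalSpace E] (f : E ≃ₜ E) (U : Clopens E) : Clopens E :=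
  ⟨f '' (U : Set E), f.isClosedMap _ U.isClopen.isClosed, f.isOpenMap _ U.isClopen.isOpen⟩

/-- `Homeo(E) → Aut(Ω(E))`, `f ↦ (U ↦ f(U))`, where `Ω(E)` is the Boolean algebra of clopen
sets.  Automorphisms of a Boolean algebra are the same as its order automorphisms. -/
def clopenAction (E : Type*) [TopologicalSpace E] : (E ≃ₜ E) →* (Clopens E ≃o Clopens E) where
  toFun f :=
    { toFun := imageClopen f
      invFun := imageClopen f.symm
      left_inv := fun U => Clopens.ext (f.toEquiv.symm_image_image U)
      right_inv := fun U => Clopens.ext (f.toEquiv.image_symm_image U)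
      map_rel_iff' := by
        intro U V
        exact Set.image_subset_image_iff f.injective }
  map_one' := RelIso.ext fun U => Clopens.ext (Set.image_id _)
  map_mul' f g := RelIso.ext fun U => Clopens.ext (Set.image_comp f g _)

/-- The Stone space `E(B)`: ultrafilters on `B`, i.e. maximal proper filters. -/
def StoneSpace (B : Type*) [BooleanAlgebra B] : Type _ :=
  {ω : Order.PFilter B // Maximal (fun F : Order.PFilter B => (F : Set B) ≠ Set.univ) ω}

/-- The topology on `E(B)` generated by the sets `U_b = {ω | b ∈ ω}`. -/
instance stoneTopology (B : Type*) [BooleanAlgebra B] : TopologicalSpace (StoneSpace B) :=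
  TopologicalSpace.generateFrom (Set.range fun b : B => {ω : StoneSpace B | b ∈ ω.1})

/-- The image `{φ b | b ∈ F}` of a filter under an automorphism. -/
def mapFilter {B : Type*} [BooleanAlgebra B] (φ : B ≃o B) (F : Order.PFilter B) :
    Order.PFilter B :=
  Order.IsPFilter.toPFilter (F := φ '' (F : Set B)) <| by
    refine Order.IsPFilter.of_def (F.nonempty.image _) ?_ ?_
    · rintro _ ⟨a, ha, rfl⟩ _ ⟨b, hb, rfl⟩
      obtain ⟨c, hc, h1, h2⟩ := F.directed a ha b hb
      exact ⟨φ c, ⟨c, hc, rfl⟩, φ.monotone h1, φ.monotone h2⟩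
    · rintro _ y h ⟨a, ha, rfl⟩
      exact ⟨φ.symm y, Order.PFilter.mem_of_le (by simpa using φ.symm.monotone h) ha, by simp⟩

theorem coe_mapFilter {B : Type*} [BooleanAlgebra B] (φ : B ≃o B) (F : Order.PFilter B) :
    (mapFilter φ F : Set B) = φ '' (F : Set B) := rfl

theorem mapFilter_symm {B : Type*} [BooleanAlgebra B] (φ : B ≃o B) (F : Order.PFilter B) :
    mapFilter φ (mapFilter φ.symm F) = F :=
  Order.PFilter.ext _ _ (φ.toEquiv.image_symm_image F)

theorem mapFilter_mono {B : Type*} [BooleanAlgebra B] (φ : B ≃o B) {F G : Order.PFilter B}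
    (h : F ≤ G) : mapFilter φ F ≤ mapFilter φ G :=
  Set.image_mono h

theorem mapFilter_proper {B : Type*} [BooleanAlgebra B] (φ : B ≃o B) {F : Order.PFilter B}
    (h : (F : Set B) ≠ Set.univ) : (mapFilter φ F : Set B) ≠ Set.univ := by
  intro h'
  apply h
  rw [coe_mapFilter] at h'
  rw [Set.eq_univ_iff_forall] at h' ⊢
  intro b
  obtain ⟨a, ha, hab⟩ := h' (φ b)
  rwa [← φ.injective hab]

/-- The image `{φ b | b ∈ ω}` of an ultrafilter under an automorphism. -/
def mapUltrafilter {B : Type*} [BooleanAlgebra B] (φ : B ≃o B) (ω : StoneSpace B) :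
    StoneSpace B :=
  ⟨mapFilter φ ω.1, mapFilter_proper φ ω.2.1, fun G hG h => by
    have h1 : ω.1 ≤ mapFilter φ.symm G := by
      have := mapFilter_mono φ.symm h
      rwa [show mapFilter φ.symm (mapFilter φ ω.1) = ω.1 from mapFilter_symm φ.symm ω.1] at this
    have h2 := mapFilter_mono φ (ω.2.2 (mapFilter_proper φ.symm hG) h1)
    rwa [mapFilter_symm] at h2⟩

theorem mapUltrafilter_continuous {B : Type*} [BooleanAlgebra B] (φ : B ≃o B) :
    Continuous (mapUltrafilter φ) := by
  refine continuous_generateFrom_iff.2 ?_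
  rintro _ ⟨b, rfl⟩
  refine isOpen_generateFrom_of_mem ⟨φ.symm b, ?_⟩
  ext ω
  change φ.symm b ∈ ω.1 ↔ b ∈ φ '' (ω.1 : Set B)
  constructor
  · intro h
    exact ⟨_, h, by simp⟩
  · rintro ⟨a, ha, rfl⟩
    simpa using ha

/-- `Aut(B) → Homeo(E(B))`, `φ ↦ (ω ↦ φ(ω))`. -/
def stoneAction (B : Type*) [BooleanAlgebra B] : (B ≃o B) →* (StoneSpace B ≃ₜ StoneSpace B) where
  toFun φ :=
    { toFun := mapUltrafilter φ
      invFun := mapUltrafilter φ.symm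
      left_inv := fun ω => Subtype.ext (mapFilter_symm φ.symm ω.1)
      right_inv := fun ω => Subtype.ext (mapFilter_symm φ ω.1)
      continuous_toFun := mapUltrafilter_continuous φ
      continuous_invFun := mapUltrafilter_continuous φ.symm }
  map_one' := Homeomorph.ext fun _ => Subtype.ext (Order.PFilter.ext _ _ (Set.image_id _))
  map_mul' φ ψ := Homeomorph.ext fun _ => Subtype.ext (Order.PFilter.ext _ _ (Set.image_comp φ ψ _))

/-! ### The complex of cuts -/

/-- A cut of `B`: an unordered pair `{a, ¬a}`. -/
def IsCut {B : Type*} [BooleanAlgebra B] (s : Sym2 B) : Prop := ∃ a : B, s = s(a, aᶜ)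

/-- Neither side is `0` or an atom. -/
def IsNonperipheral {B : Type*} [BooleanAlgebra B] (s : Sym2 B) : Prop :=
  ∀ a ∈ s, a ≠ ⊥ ∧ ¬ IsAtom a

/-- Two cuts cross if all four meets of a side of one with a side of the other are nonzero. -/
def Crosses {B : Type*} [BooleanAlgebra B] (s t : Sym2 B) : Prop :=
  ∀ a ∈ s, ∀ b ∈ t, a ⊓ b ≠ ⊥

/-- The non-peripheral cuts of `B`. -/
def CutVertex (B : Type*) [BooleanAlgebra B] : Type _ :=
  {s : Sym2 B // IsCut s ∧ IsNonperipheral s}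

/-- The complex of cuts `𝒞(B)`: its vertices are the non-peripheral cuts, and distinct cuts are
adjacent when they are compatible, i.e. do not cross.  For a Stone space `E` the complex `𝒞(E)`
is `cutComplex (Clopens E)`; see `isNonperipheral_clopens_iff` and `crosses_clopens_iff`. -/
def cutComplex (B : Type*) [BooleanAlgebra B] : SimpleGraph (CutVertex B) where
  Adj s t := s ≠ t ∧ ¬ Crosses s.1 t.1
  symm := ⟨fun s t h => ⟨h.1.symm, fun h' => h.2 fun a ha b hb => by
    rw [inf_comm]; exact h' b hb a ha⟩⟩
  loopless := ⟨fun _ h => h.1 rfl⟩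

/-- In a Stone space, a cut `U ⊔ V` is non-peripheral iff `U` and `V` each contain at least two
points. -/
theorem isNonperipheral_clopens_iff {E : Type*} [TopologicalSpace E] [CompactSpace E] [T2Space E]
    [TotallyDisconnectedSpace E] (s : Sym2 (Clopens E)) :
    IsNonperipheral s ↔ ∀ U ∈ s, (U : Set E).Nontrivial := by
  refine forall_congr' fun U => imp_congr_right fun _ => ?_
  constructor
  · rintro ⟨h0, h1⟩
    by_contra h
    rw [Set.not_nontrivial_iff] at h
    refine h1 ⟨h0, fun V hV => ?_⟩
    refine Clopens.ext (Set.eq_empty_of_forall_notMem fun x hx => hV.not_ge ?_)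
    intro y hy
    rwa [h hy (hV.le hx)]
  · rintro ⟨x, hx, y, hy, hxy⟩
    refine ⟨fun h => by rw [h] at hx; exact hx, fun h => ?_⟩
    obtain ⟨V, hV, hxV, hVy⟩ := exists_isClopen_of_totally_separated (α := E) hxy
    have hle : U ⊓ ⟨V, hV⟩ ≤ U := inf_le_left
    rcases h.le_iff.1 hle with h2 | h2
    · have : x ∈ U ⊓ ⟨V, hV⟩ := ⟨hx, hxV⟩
      rw [h2] at this
      exact this
    · have : y ∈ U ⊓ ⟨V, hV⟩ := by rw [h2]; exact hy
      exact hVy this.2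

/-- Two cuts of a space cross iff all four intersections of their sides are nonempty. -/
theorem crosses_clopens_iff {E : Type*} [TopologicalSpace E] (s t : Sym2 (Clopens E)) :
    Crosses s t ↔ ∀ U ∈ s, ∀ V ∈ t, ((U : Set E) ∩ (V : Set E)).Nonempty := by
  refine forall₂_congr fun U _ => forall₂_congr fun V _ => ?_
  rw [Set.nonempty_iff_ne_empty, not_iff_not, SetLike.ext'_iff]
  rfl

theorem map_isCut {B : Type*} [BooleanAlgebra B] (φ : B ≃o B) {s : Sym2 B} (h : IsCut s) :
    IsCut (s.map φ) := by
  obtain ⟨a, rfl⟩ := h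
  exact ⟨φ a, by simp⟩

theorem map_isNonperipheral {B : Type*} [BooleanAlgebra B] (φ : B ≃o B) {s : Sym2 B}
    (h : IsNonperipheral s) : IsNonperipheral (s.map φ) := by
  intro b hb
  obtain ⟨a, ha, rfl⟩ := Sym2.mem_map.1 hb
  exact ⟨by simpa using (h a ha).1, by simpa using (h a ha).2⟩

theorem map_crosses_iff {B : Type*} [BooleanAlgebra B] (φ : B ≃o B) (s t : Sym2 B) :
    Crosses (s.map φ) (t.map φ) ↔ Crosses s t := by
  simp only [Crosses, Sym2.mem_map, forall_exists_index, and_imp, forall_apply_eq_imp_iff₂,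
    ← map_inf, ne_eq, map_eq_bot_iff]

/-- The action of an automorphism on cuts, `{a, ¬a} ↦ {φ a, ¬φ a}`. -/
def mapCut {B : Type*} [BooleanAlgebra B] (φ : B ≃o B) (s : CutVertex B) : CutVertex B :=
  ⟨s.1.map φ, map_isCut φ s.2.1, map_isNonperipheral φ s.2.2⟩

theorem mapCut_symm {B : Type*} [BooleanAlgebra B] (φ : B ≃o B) (s : CutVertex B) :
    mapCut φ (mapCut φ.symm s) = s :=
  Subtype.ext <| by
    change Sym2.map φ (Sym2.map φ.symm s.1) = s.1
    rw [Sym2.map_map, show (φ ∘ φ.symm : B → B) = id from funext φ.apply_symm_apply, Sym2.map_id]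
    rfl

/-- The natural map `Aut(B) → Aut(𝒞(B))`. -/
def autCutAction (B : Type*) [BooleanAlgebra B] :
    (B ≃o B) →* (cutComplex B ≃g cutComplex B) where
  toFun φ :=
    { toFun := mapCut φ
      invFun := mapCut φ.symm
      left_inv := mapCut_symm φ.symm
      right_inv := mapCut_symm φ
      map_rel_iff' := by
        intro s t
        refine and_congr (not_congr ?_) (not_congr (map_crosses_iff φ s.1 t.1))
        refine ⟨fun h => ?_, fun h => congrArg (mapCut φ) h⟩
        have h' := congrArg (mapCut φ.symm) h
        exact (mapCut_symm φ.symm s).symm.trans (h'.trans (mapCut_symm φ.symm t)) }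
  map_one' := RelIso.ext fun s => Subtype.ext <| by
    change Sym2.map id s.1 = s.1
    simp
  map_mul' φ ψ := RelIso.ext fun s => Subtype.ext (Sym2.map_map (g := φ) (f := ψ) s.1).symm

/-- The natural map `Homeo(E) → Aut(𝒞(E))`, `U ⊔ V ↦ f(U) ⊔ f(V)`. -/
def homeoCutAction (E : Type*) [TopologicalSpace E] :
    (E ≃ₜ E) →* (cutComplex (Clopens E) ≃g cutComplex (Clopens E)) :=
  (autCutAction (Clopens E)).comp (clopenAction E)

/-- The homomorphism `f` is an isomorphism of topological groups. -/
def IsTopGroupIso {G H : Type*} [Group G] [TopologicalSpace G] [Group H] [TopologicalSpace H]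
    (f : G →* H) : Prop :=
  ∃ e : G ≃ₜ* H, ∀ g, e g = f g

/-! The heart is that `Aut(B) → Aut(𝒞(B))` is bijective and a homeomorphism; the rest is Stone
duality. All counting runs through an abstract point count `s : B → ℕ∞` with `5 ≤ s ⊤`, so that one
argument serves both `Clopens E` and an abstract `B`.

Orient the cuts: a side is a thick element with thick complement, and a cut is a pair of opposite
sides. The graph recovers the order on sides. Two neighbours of a cut `w` lie on the same side of
`w` exactly when they cross each other or both cross some neighbour of `w` (`graphSameSide_iff`).
Hence a graph automorphism, once one neighbour has fixed the orientation of a cut, carries sides to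
sides, and it lifts to an order automorphism `Ψ` of `Side B` commuting with complements
(`exists_lift`).

It remains to extend `Ψ` to `B`. Every element has the form `(c ⊓ d) ⊔ (e ⊓ f)` with `c d e f` sides
(`exists_sides_eq`), so it suffices that `Ψ` preserves which fourfold meets of sides vanish. The
order and the complement see this at once for two sides; the crux is three sides
(`map_inf₃_ne_bot`). There five points are essential: with four points the sides form an antichain,
and exchanging `{1,4}` with `{2,3}` alone destroys the common point of `{1,2}`, `{1,3}`, `{1,4}`.
The extension then comes from matching elements that meet pairs of sides in the same way
(`Corresponds`), which avoids choosing representations (`exists_orderIso_extending`).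

Injectivity and the agreement of topologies hold because finitely many fixed cuts force a given
element to be fixed: a nested pair of fixed cuts cannot be flipped (`apply_eq_of_mapCut_eq`). For
the diameter, two crossing cuts have four corners sharing at least five points, so some corner is
thick, and its cut is adjacent to both. This gives diameter at most two in the finite case as well.
-/

/-! ### Elements with at least two points -/

/-- The element is neither `0` nor an atom. -/
def IsThick {B : Type*} [BooleanAlgebra B] (a : B) : Prop := a ≠ ⊥ ∧ ¬ IsAtom a

theorem IsThick.mono {B : Type*} [BooleanAlgebra B] {a b : B} (ha : IsThick a) (h : a ≤ b) :
    IsThick b := by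
  refine ⟨fun hb => ha.1 (le_bot_iff.1 (hb ▸ h)), fun hb => ?_⟩
  rcases hb.le_iff.1 h with h | h
  · exact ha.1 h
  · exact ha.2 (h ▸ hb)

theorem isAtom_of_not_isThick {B : Type*} [BooleanAlgebra B] {a : B} (h0 : a ≠ ⊥)
    (h : ¬ IsThick a) : IsAtom a := by
  by_contra h'
  exact h ⟨h0, h'⟩

theorem IsThick.sup {B : Type*} [BooleanAlgebra B] {a b : B} (ha : a ≠ ⊥) (hb : b ≠ ⊥)
    (h : a ⊓ b = ⊥) : IsThick (a ⊔ b) := by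
  refine ⟨fun h' => ha (le_bot_iff.1 (h' ▸ le_sup_left)), fun h' => ?_⟩
  rcases h'.le_iff.1 (le_sup_left : a ≤ a ⊔ b) with h1 | h1
  · exact ha h1
  · rcases h'.le_iff.1 (le_sup_right : b ≤ a ⊔ b) with h2 | h2
    · exact hb h2
    · rw [h1, ← h2] at h
      simp at h
      exact hb h

theorem IsThick.exists_split {B : Type*} [BooleanAlgebra B] {a : B} (ha : IsThick a) :
    ∃ b c : B, b ≠ ⊥ ∧ c ≠ ⊥ ∧ b ⊓ c = ⊥ ∧ b ⊔ c = a := by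
  have h : ∃ b < a, b ≠ ⊥ := by
    by_contra! h
    exact ha.2 ⟨ha.1, h⟩
  obtain ⟨b, hb, hb0⟩ := h
  refine ⟨b, a \ b, hb0, fun h => hb.not_ge (sdiff_eq_bot_iff.1 h), ?_, ?_⟩
  · exact inf_sdiff_self_right
  · exact sup_sdiff_cancel_right hb.le

/-- A function that behaves like the number of points of the Stone space that lie in `a`. -/
structure IsPointCount {B : Type*} [BooleanAlgebra B] (s : B → ℕ∞) : Prop where
  sup : ∀ a b, a ⊓ b = ⊥ → s (a ⊔ b) = s a + s b
  eq_zero : ∀ a, s a = 0 ↔ a = ⊥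
  eq_one : ∀ a, s a = 1 ↔ IsAtom a

/-! ### Splitting elements by counting points -/

namespace IsPointCount

variable {B : Type*} [BooleanAlgebra B] {s : B → ℕ∞}

theorem isThick_iff (hs : IsPointCount s) {a : B} : IsThick a ↔ 2 ≤ s a := by
  rw [IsThick, ne_eq, ← hs.eq_zero, ← hs.eq_one]
  generalize s a = n
  enat_to_nat <;> first | omega | simp_all

theorem add_compl (hs : IsPointCount s) (a : B) : s a + s aᶜ = s ⊤ := by
  rw [← hs.sup _ _ (by simp), sup_compl_eq_top]

theorem exists_isThick_lt (hs : IsPointCount s) {a : B} (h : 3 ≤ s a) :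
    ∃ b < a, IsThick b := by
  have ha : IsThick a := hs.isThick_iff.2 (le_trans (by norm_num) h)
  obtain ⟨b, c, hb, hc, hbc, rfl⟩ := ha.exists_split
  rw [hs.sup _ _ hbc] at h
  have : 2 ≤ s b ∨ 2 ≤ s c := by
    revert h
    generalize s b = m
    generalize s c = n
    intro h
    by_contra! h'
    enat_to_nat <;> first | omega | simp_all
  rw [← hs.isThick_iff, ← hs.isThick_iff] at this
  rcases this with h' | h'
  · exact ⟨b, left_lt_sup.2 fun h => hc (by rwa [inf_eq_right.2 h] at hbc), h'⟩
  · exact ⟨c, right_lt_sup.2 fun h => hb (by rwa [inf_eq_left.2 h] at hbc), h'⟩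

/-- Take a thick `b < a`. If `a \ b` is too small it is an atom, so `b` still has three points;
shrinking `b` to a thick `c < b` moves a further nonzero piece into the complement. -/
theorem exists_isThick_split (hs : IsPointCount s) {a : B} (h : 4 ≤ s a) :
    ∃ b c : B, IsThick b ∧ IsThick c ∧ b ⊓ c = ⊥ ∧ b ⊔ c = a := by
  obtain ⟨b, hba, hb⟩ := hs.exists_isThick_lt (le_trans (by norm_num) h)
  by_cases hd : IsThick (a \ b)
  · exact ⟨b, a \ b, hb, hd, inf_sdiff_self_right, sup_sdiff_cancel_right hba.le⟩
  have h0 : a \ b ≠ ⊥ := fun h => hba.not_ge (sdiff_eq_bot_iff.1 h)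
  have h1 := hs.eq_one _ |>.2 (isAtom_of_not_isThick h0 hd)
  have h2 := hs.sup b (a \ b) inf_sdiff_self_right
  rw [sup_sdiff_cancel_right hba.le, h1] at h2
  have h3 : 3 ≤ s b := by
    revert h h2
    generalize s a = m
    generalize s b = n
    intro h h2
    subst h2
    enat_to_nat; omega
  obtain ⟨c, hcb, hc⟩ := hs.exists_isThick_lt h3
  refine ⟨c, a \ c, hc, ?_, inf_sdiff_self_right, sup_sdiff_cancel_right (hcb.trans hba).le⟩
  refine (IsThick.sup (fun h => hcb.not_ge (sdiff_eq_bot_iff.1 h)) h0 ?_ :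
    IsThick (b \ c ⊔ a \ b)).mono (sup_le (sdiff_le_sdiff_right hba.le)
      (sdiff_le_sdiff_left hcb.le))
  exact le_bot_iff.1 ((inf_le_inf_right _ sdiff_le).trans inf_sdiff_self_right.le)

theorem four_le_of_not_isThick_compl (hs : IsPointCount s) (h5 : 5 ≤ s ⊤) {a : B}
    (h : ¬ IsThick aᶜ) : 4 ≤ s a := by
  have := hs.add_compl a
  rw [hs.isThick_iff] at h
  rw [← this] at h5
  revert h h5
  generalize s a = m
  generalize s aᶜ = n
  intro h h5
  by_contra! h'
  enat_to_nat <;> first | omega | simp_all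

end IsPointCount

/-! ### Sides of non-peripheral cuts -/

/-- The sides of non-peripheral cuts. -/
@[ext]
structure Side (B : Type*) [BooleanAlgebra B] where
  /-- The underlying element. -/
  val : B
  prop : IsThick val ∧ IsThick valᶜ

namespace Side

variable {B : Type*} [BooleanAlgebra B]

instance : PartialOrder (Side B) := PartialOrder.lift Side.val fun _ _ => Side.ext

instance : Compl (Side B) := ⟨fun a => ⟨a.1ᶜ, a.2.2, by rw [compl_compl]; exact a.2.1⟩⟩

theorem val_compl (a : Side B) : (aᶜ).1 = a.1ᶜ := rfl

theorem compl_compl (a : Side B) : aᶜᶜ = a := Side.ext (_root_.compl_compl a.1)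

end Side

/-! ### Building the elements of the algebra from sides -/

namespace IsPointCount

variable {B : Type*} [BooleanAlgebra B] {s : B → ℕ∞}

/-- The complement of an atom has at least four points, hence splits into thick `y` and `z`; the
sides `x ⊔ y` and `x ⊔ z` share only `x`. -/
theorem exists_side_inf_eq_of_isAtom (hs : IsPointCount s) (h5 : 5 ≤ s ⊤) {x : B}
    (hx : IsAtom x) : ∃ c d : Side B, c.1 ⊓ d.1 = x := by
  have h4 : 4 ≤ s xᶜ := by
    refine hs.four_le_of_not_isThick_compl h5 ?_
    rw [compl_compl]
    exact fun h => h.2 hx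
  obtain ⟨y, z, hy, hz, hyz, h⟩ := hs.exists_isThick_split h4
  have hyx : y ≤ xᶜ := h ▸ le_sup_left
  have hzx : z ≤ xᶜ := h ▸ le_sup_right
  refine ⟨⟨x ⊔ y, hy.mono le_sup_right, hz.mono ?_⟩, ⟨x ⊔ z, hz.mono le_sup_right, hy.mono ?_⟩, ?_⟩
  · rw [compl_sup]
    exact le_inf hzx (le_compl_iff_disjoint_left.2 (disjoint_iff.2 hyz))
  · rw [compl_sup]
    exact le_inf hyx (le_compl_iff_disjoint_right.2 (disjoint_iff.2 hyz))
  · change (x ⊔ y) ⊓ (x ⊔ z) = x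
    rw [← sup_inf_left, hyz, sup_bot_eq]

theorem exists_side_sup_eq (hs : IsPointCount s) (h5 : 5 ≤ s ⊤) {x : B} (hx : ¬ IsThick xᶜ) :
    ∃ c d : Side B, c.1 ⊔ d.1 = x := by
  obtain ⟨y, z, hy, hz, hyz, h⟩ := hs.exists_isThick_split (hs.four_le_of_not_isThick_compl h5 hx)
  exact ⟨⟨y, hy, hz.mono (le_compl_iff_disjoint_left.2 (disjoint_iff.2 hyz))⟩,
    ⟨z, hz, hy.mono (le_compl_iff_disjoint_right.2 (disjoint_iff.2 hyz))⟩, h⟩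

theorem nonempty_side (hs : IsPointCount s) (h5 : 5 ≤ s ⊤) : Nonempty (Side B) := by
  obtain ⟨c, -⟩ := hs.exists_side_sup_eq h5 (x := ⊤) (by simp [IsThick])
  exact ⟨c⟩

theorem exists_side_inf_le (hs : IsPointCount s) (h5 : 5 ≤ s ⊤) {x : B} (hx : x ≠ ⊥) :
    ∃ c d : Side B, c.1 ⊓ d.1 ≤ x ∧ c.1 ⊓ d.1 ≠ ⊥ := by
  by_cases hx1 : IsThick x
  · by_cases hx2 : IsThick xᶜ
    · exact ⟨⟨x, hx1, hx2⟩, ⟨x, hx1, hx2⟩, by simpa using hx⟩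
    · obtain ⟨c, d, rfl⟩ := hs.exists_side_sup_eq h5 hx2
      exact ⟨c, c, by simpa using c.2.1.1⟩
  · obtain ⟨c, d, rfl⟩ := hs.exists_side_inf_eq_of_isAtom h5 (isAtom_of_not_isThick hx hx1)
    exact ⟨c, d, le_rfl, hx⟩

/-- An element that is not a side is `⊥`, an atom, or has a complement that is not thick; these are
respectively `c ⊓ cᶜ`, a meet of two sides, and a join of two sides. The common shape lets one
formula cover all cases. -/
theorem exists_sides_eq (hs : IsPointCount s) (h5 : 5 ≤ s ⊤) (x : B) :
    ∃ c d e f : Side B, (c.1 ⊓ d.1) ⊔ (e.1 ⊓ f.1) = x := by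
  by_cases hx1 : IsThick x
  · by_cases hx2 : IsThick xᶜ
    · exact ⟨⟨x, hx1, hx2⟩, ⟨x, hx1, hx2⟩, ⟨x, hx1, hx2⟩, ⟨x, hx1, hx2⟩, by simp⟩
    · obtain ⟨c, d, rfl⟩ := hs.exists_side_sup_eq h5 hx2
      exact ⟨c, c, d, d, by simp⟩
  · by_cases hx : x = ⊥
    · obtain ⟨c⟩ := hs.nonempty_side h5
      exact ⟨c, cᶜ, c, cᶜ, by simp [Side.val_compl, hx]⟩
    · obtain ⟨c, d, rfl⟩ := hs.exists_side_inf_eq_of_isAtom h5 (isAtom_of_not_isThick hx hx1)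
      exact ⟨c, d, c, d, by simp⟩

theorem isThick_compl_of_isAtom (hs : IsPointCount s) (h5 : 5 ≤ s ⊤) {p q r : B}
    (hp : IsAtom p) (hq : IsAtom q) (hr : IsAtom r) (hpq : p ⊓ q = ⊥) (hpr : p ⊓ r = ⊥)
    (hqr : q ⊓ r = ⊥) : IsThick (p ⊔ q ⊔ r)ᶜ := by
  rw [hs.isThick_iff]
  have h := hs.add_compl (p ⊔ q ⊔ r)
  rw [hs.sup (p ⊔ q) r (by rw [inf_sup_right, hpr, hqr, sup_bot_eq]), hs.sup p q hpq,
    (hs.eq_one p).2 hp, (hs.eq_one q).2 hq, (hs.eq_one r).2 hr] at h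
  rw [← h] at h5
  revert h5
  generalize s (p ⊔ q ⊔ r)ᶜ = n
  intro h5
  enat_to_nat; omega

/-- One of the two sides of a non-peripheral cut contains another side properly. -/
theorem exists_side_lt (hs : IsPointCount s) (h5 : 5 ≤ s ⊤) (a : Side B) :
    ∃ b : Side B, b < a ∨ b < aᶜ := by
  have h : 3 ≤ s a.1 ∨ 3 ≤ s a.1ᶜ := by
    rw [← hs.add_compl a.1] at h5
    revert h5
    generalize s a.1 = m
    generalize s a.1ᶜ = n
    intro h5
    by_contra! h'
    enat_to_nat <;> first | omega | simp_all
  rcases h with h | h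
  · obtain ⟨b, hb, hb2⟩ := hs.exists_isThick_lt h
    exact ⟨⟨b, hb2, a.2.2.mono (compl_le_compl hb.le)⟩, Or.inl hb⟩
  · obtain ⟨b, hb, hb2⟩ := hs.exists_isThick_lt h
    exact ⟨⟨b, hb2, (aᶜ).2.2.mono (compl_le_compl hb.le)⟩, Or.inr hb⟩

/-- If two cuts cross, then one of the four corners is not an atom. -/
theorem exists_isThick_corner (hs : IsPointCount s) (h5 : 5 ≤ s ⊤) (a b : B) :
    IsThick (a ⊓ b) ∨ IsThick (a ⊓ bᶜ) ∨ IsThick (aᶜ ⊓ b) ∨ IsThick (aᶜ ⊓ bᶜ) := by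
  simp only [hs.isThick_iff]
  have h (x : B) : s (x ⊓ b) + s (x ⊓ bᶜ) = s x := by
    rw [← hs.sup, ← inf_sup_left, sup_compl_eq_top, inf_top_eq]
    rw [inf_inf_inf_comm, inf_compl_eq_bot, inf_bot_eq]
  rw [← hs.add_compl a, ← h a, ← h aᶜ] at h5
  revert h5
  generalize s (a ⊓ b) = m
  generalize s (a ⊓ bᶜ) = n
  generalize s (aᶜ ⊓ b) = k
  generalize s (aᶜ ⊓ bᶜ) = l
  intro h5
  by_contra! h'
  obtain ⟨h1, h2, h3, h4⟩ := h'
  enat_to_nat; omega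

end IsPointCount

/-! ### Extending order automorphisms of the set of sides -/

namespace Side

variable {B : Type*} [BooleanAlgebra B] {s : B → ℕ∞} {Ψ : Side B ≃o Side B}

theorem map_compl_symm (hΨ : ∀ a, Ψ aᶜ = (Ψ a)ᶜ) (a : Side B) :
    Ψ.symm aᶜ = (Ψ.symm a)ᶜ := by
  rw [Ψ.symm_apply_eq, hΨ, Ψ.apply_symm_apply]

theorem inf_eq_bot_iff {a b : Side B} : a.1 ⊓ b.1 = ⊥ ↔ a ≤ bᶜ := by
  rw [← disjoint_iff, ← le_compl_iff_disjoint_right]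
  rfl

theorem map_inf_eq_bot_iff (hΨ : ∀ a, Ψ aᶜ = (Ψ a)ᶜ) {a b : Side B} :
    (Ψ a).1 ⊓ (Ψ b).1 = ⊥ ↔ a.1 ⊓ b.1 = ⊥ := by
  rw [inf_eq_bot_iff, inf_eq_bot_iff, ← hΨ, Ψ.le_iff_le]

/-- A meet in `B` that happens to be a side is the infimum in the poset of sides. The meet of the
images is a side too, since it lies above `Ψ m`, so the inverse of `Ψ` can be applied to it. -/
theorem map_inf (Ψ : Side B ≃o Side B) {a b m : Side B} (h : m.1 = a.1 ⊓ b.1) :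
    (Ψ m).1 = (Ψ a).1 ⊓ (Ψ b).1 := by
  have h1 : m ≤ a := h.le.trans inf_le_left
  have h2 : m ≤ b := h.le.trans inf_le_right
  have h3 : (Ψ m).1 ≤ (Ψ a).1 ⊓ (Ψ b).1 := le_inf (Ψ.monotone h1) (Ψ.monotone h2)
  refine h3.antisymm ?_
  let n : Side B := ⟨(Ψ a).1 ⊓ (Ψ b).1, (Ψ m).2.1.mono h3,
    (Ψ a).2.2.mono (compl_le_compl inf_le_left)⟩
  change n ≤ Ψ m
  rw [← Ψ.symm_apply_le]
  change (Ψ.symm n).1 ≤ m.1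
  rw [h]
  exact le_inf (Ψ.symm_apply_le.2 (inf_le_left : n.1 ≤ (Ψ a).1))
    (Ψ.symm_apply_le.2 (inf_le_right : n.1 ≤ (Ψ b).1))

theorem map_sup (hΨ : ∀ a, Ψ aᶜ = (Ψ a)ᶜ) {a b m : Side B} (h : m.1 = a.1 ⊔ b.1) :
    (Ψ m).1 = (Ψ a).1 ⊔ (Ψ b).1 := by
  have := map_inf Ψ (a := aᶜ) (b := bᶜ) (m := mᶜ) (by simp [val_compl, h])
  rw [hΨ, hΨ, hΨ, val_compl, val_compl, val_compl, ← compl_sup, compl_inj_iff] at this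
  exact this

theorem isThick_inf_of_map (Ψ : Side B ≃o Side B) {a b : Side B}
    (h : IsThick ((Ψ a).1 ⊓ (Ψ b).1)) : IsThick (a.1 ⊓ b.1) := by
  let n : Side B := ⟨(Ψ a).1 ⊓ (Ψ b).1, h, (Ψ a).2.2.mono (compl_le_compl inf_le_left)⟩
  have := map_inf Ψ.symm (a := Ψ a) (b := Ψ b) (m := n) rfl
  rw [Ψ.symm_apply_apply, Ψ.symm_apply_apply] at this
  rw [← this]
  exact (Ψ.symm n).2.1

/-- Triple meets are preserved to be nonzero: this is where five points are needed. -/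
theorem map_inf₃_ne_bot (hs : IsPointCount s) (h5 : 5 ≤ s ⊤) (hΨ : ∀ a, Ψ aᶜ = (Ψ a)ᶜ)
    {a b c : Side B} (h : a.1 ⊓ b.1 ⊓ c.1 ≠ ⊥) : (Ψ a).1 ⊓ (Ψ b).1 ⊓ (Ψ c).1 ≠ ⊥ := by
  -- In a counterexample no pairwise meet is thick, since a thick one would be a side and reduce the
  -- claim to two sides. So the pairwise meets are atoms, each below the third side, and their
  -- images are atoms too.
  intro h0
  have key : ∀ x y z : Side B, x.1 ⊓ y.1 ⊓ z.1 ≠ ⊥ → (Ψ x).1 ⊓ (Ψ y).1 ⊓ (Ψ z).1 = ⊥ →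
      ¬ IsThick (x.1 ⊓ y.1) ∧ IsAtom ((Ψ x).1 ⊓ (Ψ y).1) ∧ x.1 ⊓ y.1 ≤ z.1 := by
    intro x y z h h0
    have h1 : ¬ IsThick (x.1 ⊓ y.1) := by
      intro ht
      let m : Side B := ⟨x.1 ⊓ y.1, ht, x.2.2.mono (compl_le_compl inf_le_left)⟩
      have hm := map_inf Ψ (a := x) (b := y) (m := m) rfl
      rw [← hm, map_inf_eq_bot_iff hΨ] at h0
      exact h h0
    have h2 : x.1 ⊓ y.1 ≠ ⊥ := fun h' => h (by rw [h', bot_inf_eq])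
    refine ⟨h1, isAtom_of_not_isThick ?_ fun h' => h1 (isThick_inf_of_map Ψ h'), ?_⟩
    · rwa [ne_eq, map_inf_eq_bot_iff hΨ]
    · rcases (isAtom_of_not_isThick h2 h1).le_iff.1
        (inf_le_left : x.1 ⊓ y.1 ⊓ z.1 ≤ x.1 ⊓ y.1) with h' | h'
      · exact absurd h' h
      · exact inf_eq_left.1 h'
  obtain ⟨nab, hr, hab⟩ := key a b c h h0
  obtain ⟨nac, hq, hac⟩ := key a c b (by rwa [inf_right_comm]) (by rwa [inf_right_comm])
  obtain ⟨nbc, hp, hbc⟩ := key b c a (by rwa [inf_comm, ← inf_assoc])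
    (by rwa [inf_comm, ← inf_assoc])
  set A := (Ψ a).1
  set C := (Ψ b).1
  set D := (Ψ c).1
  have hpq : (C ⊓ D) ⊓ (A ⊓ D) = ⊥ := by
    rw [← le_bot_iff, ← h0]
    exact le_inf (le_inf (inf_le_right.trans inf_le_left) (inf_le_left.trans inf_le_left))
      (inf_le_left.trans inf_le_right)
  have hpr : (C ⊓ D) ⊓ (A ⊓ C) = ⊥ := by
    rw [← le_bot_iff, ← h0]
    exact le_inf (le_inf (inf_le_right.trans inf_le_left) (inf_le_left.trans inf_le_left))
      (inf_le_left.trans inf_le_right)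
  have hqr : (A ⊓ D) ⊓ (A ⊓ C) = ⊥ := by
    rw [← le_bot_iff, ← h0]
    exact le_inf inf_le_right (inf_le_left.trans inf_le_right)
  -- Three disjoint atoms leave at least two of the five points, so their pairwise joins and their
  -- total join are all sides.
  have ht := hs.isThick_compl_of_isAtom h5 hp hq hr hpq hpr hqr
  set p := C ⊓ D
  set q := A ⊓ D
  set r := A ⊓ C
  let x : Side B := ⟨q ⊔ r, IsThick.sup hq.1 hr.1 hqr,
    ht.mono (compl_le_compl (sup_le (le_sup_right.trans le_sup_left) le_sup_right))⟩
  let y : Side B := ⟨p ⊔ r, IsThick.sup hp.1 hr.1 hpr,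
    ht.mono (compl_le_compl (sup_le (le_sup_left.trans le_sup_left) le_sup_right))⟩
  let z : Side B := ⟨p ⊔ q, IsThick.sup hp.1 hq.1 hpq,
    ht.mono (compl_le_compl le_sup_left)⟩
  let w : Side B := ⟨p ⊔ q ⊔ r, z.2.1.mono le_sup_left, ht⟩
  have hx : Ψ.symm x ≤ a := Ψ.symm_apply_le.2 (sup_le inf_le_left inf_le_left : q ⊔ r ≤ A)
  have hy : Ψ.symm y ≤ b := Ψ.symm_apply_le.2 (sup_le inf_le_left inf_le_right : p ⊔ r ≤ C)
  have hz : Ψ.symm z ≤ c := Ψ.symm_apply_le.2 (sup_le inf_le_right inf_le_right : p ⊔ q ≤ D)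
  have hw := map_sup (map_compl_symm hΨ) (a := x) (b := y) (m := w)
    (by change p ⊔ q ⊔ r = (q ⊔ r) ⊔ (p ⊔ r); rw [← sup_sup_distrib_right, sup_comm p q])
  have hzw : Ψ.symm z ≤ Ψ.symm w := Ψ.symm.monotone (le_sup_left : p ⊔ q ≤ p ⊔ q ⊔ r)
  have hzw' : (Ψ.symm z).1 ≤ a.1 ⊔ b.1 := 
    (show (Ψ.symm z).1 ≤ (Ψ.symm w).1 from hzw).trans (hw.le.trans (sup_le_sup hx hy))
  -- The thick preimage of `z` lies below `(a ⊔ b) ⊓ c`, which is at most `a ⊓ b` because `a ⊓ c ≤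
  -- b` and `b ⊓ c ≤ a`. But `a ⊓ b` is not thick.
  refine nab ((Ψ.symm z).2.1.mono ?_)
  have h3 := le_inf hzw' (hz : (Ψ.symm z).1 ≤ c.1)
  rw [inf_sup_right] at h3
  exact h3.trans (sup_le (le_inf inf_le_left hac) (le_inf hbc inf_le_left))

/-- If `a ⊓ b` is thick it is a side, and three sides remain. Otherwise `Ψ a` and `Ψ b` meet in an
atom, which meets `Ψ c` and `Ψ d` separately and therefore lies below both. -/
theorem map_inf₄_ne_bot (hs : IsPointCount s) (h5 : 5 ≤ s ⊤) (hΨ : ∀ a, Ψ aᶜ = (Ψ a)ᶜ)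
    {a b c d : Side B} (h : a.1 ⊓ b.1 ⊓ c.1 ⊓ d.1 ≠ ⊥) :
    (Ψ a).1 ⊓ (Ψ b).1 ⊓ (Ψ c).1 ⊓ (Ψ d).1 ≠ ⊥ := by
  by_cases ht : IsThick (a.1 ⊓ b.1)
  · let m : Side B := ⟨a.1 ⊓ b.1, ht, a.2.2.mono (compl_le_compl inf_le_left)⟩
    have hm := map_inf Ψ (a := a) (b := b) (m := m) rfl
    rw [← hm]
    exact map_inf₃_ne_bot hs h5 hΨ h
  · have h1 : a.1 ⊓ b.1 ⊓ c.1 ≠ ⊥ := fun h' => h (by rw [h', bot_inf_eq])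
    have h2 : a.1 ⊓ b.1 ⊓ d.1 ≠ ⊥ := fun h' => h (by rw [inf_right_comm, h', bot_inf_eq])
    have h3 := map_inf₃_ne_bot hs h5 hΨ h1
    have h4 := map_inf₃_ne_bot hs h5 hΨ h2
    have hat : IsAtom ((Ψ a).1 ⊓ (Ψ b).1) := isAtom_of_not_isThick
      (fun h' => h3 (by rw [h', bot_inf_eq])) fun h' => ht (isThick_inf_of_map Ψ h')
    rwa [(hat.le_iff.1 (inf_le_left : (Ψ a).1 ⊓ (Ψ b).1 ⊓ (Ψ c).1 ≤ _)).resolve_left h3]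

theorem map_inf₄_eq_bot_iff (hs : IsPointCount s) (h5 : 5 ≤ s ⊤) (hΨ : ∀ a, Ψ aᶜ = (Ψ a)ᶜ)
    {a b c d : Side B} :
    a.1 ⊓ b.1 ⊓ c.1 ⊓ d.1 = ⊥ ↔ (Ψ a).1 ⊓ (Ψ b).1 ⊓ (Ψ c).1 ⊓ (Ψ d).1 = ⊥ := by
  rw [← not_iff_not]
  refine ⟨map_inf₄_ne_bot hs h5 hΨ, fun h => ?_⟩
  have := map_inf₄_ne_bot hs h5 (map_compl_symm hΨ) h
  simpa only [Ψ.symm_apply_apply] using this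

/-- `b'` meets pairs of images of sides as `b` meets the pairs of sides. -/
def Corresponds (Ψ : Side B ≃o Side B) (b b' : B) : Prop :=
  ∀ c d : Side B, b ⊓ c.1 ⊓ d.1 = ⊥ ↔ b' ⊓ (Ψ c).1 ⊓ (Ψ d).1 = ⊥

theorem Corresponds.symm {b b' : B} (h : Corresponds Ψ b b') : Corresponds Ψ.symm b' b := by
  intro c d
  simpa only [Ψ.apply_symm_apply] using (h (Ψ.symm c) (Ψ.symm d)).symm

/-- If `a ≤ b` failed, a nonzero meet of two sides inside `a \ b` would meet `a` but not `b`, and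
its image would contradict `a' ≤ b'`. In particular, corresponding elements determine each other. -/
theorem Corresponds.le (hs : IsPointCount s) (h5 : 5 ≤ s ⊤) {a a' b b' : B}
    (ha : Corresponds Ψ a a') (hb : Corresponds Ψ b b') (h : a' ≤ b') : a ≤ b := by
  by_contra hab
  obtain ⟨c, d, h1, h2⟩ := hs.exists_side_inf_le h5
    (fun h' => hab (sdiff_eq_bot_iff.1 h') : a \ b ≠ ⊥)
  have h3 : b ⊓ c.1 ⊓ d.1 = ⊥ := by
    rw [inf_assoc, ← le_bot_iff]
    exact (inf_le_inf_left _ h1).trans inf_sdiff_self_right.le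
  rw [hb c d, ← le_bot_iff] at h3
  have h4 := (ha c d).2 (le_bot_iff.1 ((inf_le_inf_right _ (inf_le_inf_right _ h)).trans h3))
  rw [inf_assoc, inf_eq_right.2 (h1.trans sdiff_le)] at h4
  exact h2 h4

theorem Corresponds.le_iff (hs : IsPointCount s) (h5 : 5 ≤ s ⊤) {a a' b b' : B}
    (ha : Corresponds Ψ a a') (hb : Corresponds Ψ b b') : a' ≤ b' ↔ a ≤ b :=
  ⟨ha.le hs h5 hb, ha.symm.le hs h5 hb.symm⟩

/-- By distributivity, the test against `c ⊓ d` becomes the vanishing of two fourfold meets of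
sides. -/
theorem exists_corresponds (hs : IsPointCount s) (h5 : 5 ≤ s ⊤) (hΨ : ∀ a, Ψ aᶜ = (Ψ a)ᶜ)
    (b : B) : ∃ b', Corresponds Ψ b b' := by
  obtain ⟨x, y, z, w, rfl⟩ := hs.exists_sides_eq h5 b
  refine ⟨((Ψ x).1 ⊓ (Ψ y).1) ⊔ ((Ψ z).1 ⊓ (Ψ w).1), fun c d => ?_⟩
  simp only [inf_sup_right, sup_eq_bot_iff]
  exact and_congr (map_inf₄_eq_bot_iff hs h5 hΨ) (map_inf₄_eq_bot_iff hs h5 hΨ)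

theorem corresponds_map (hs : IsPointCount s) (h5 : 5 ≤ s ⊤) (hΨ : ∀ a, Ψ aᶜ = (Ψ a)ᶜ)
    (a : Side B) : Corresponds Ψ a.1 (Ψ a).1 := by
  intro c d
  have := map_inf₄_eq_bot_iff hs h5 hΨ (a := a) (b := a) (c := c) (d := d)
  simpa only [inf_idem] using this

theorem exists_orderIso_extending (hs : IsPointCount s) (h5 : 5 ≤ s ⊤)
    (hΨ : ∀ a, Ψ aᶜ = (Ψ a)ᶜ) : ∃ φ : B ≃o B, ∀ a : Side B, φ a.1 = (Ψ a).1 := by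
  choose f hf using exists_corresponds hs h5 hΨ
  choose g hg using exists_corresponds hs h5 (map_compl_symm hΨ)
  have uniq {b b' b'' : B} (h : Corresponds Ψ b b') (h' : Corresponds Ψ b b'') : b' = b'' :=
    ((h.le_iff hs h5 h').2 le_rfl).antisymm ((h'.le_iff hs h5 h).2 le_rfl)
  have uniq' {b b' b'' : B} (h : Corresponds Ψ b' b) (h' : Corresponds Ψ b'' b) : b' = b'' :=
    ((h.le_iff hs h5 h').1 le_rfl).antisymm ((h'.le_iff hs h5 h).1 le_rfl)
  refine ⟨{ toFun := f, invFun := g, left_inv := fun b => uniq' (hg (f b)).symm (hf b),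
            right_inv := fun b => uniq (hf (g b)) (hg b).symm,
            map_rel_iff' := fun {a b} => (hf a).le_iff hs h5 (hf b) }, fun a => ?_⟩
  exact uniq (hf a.1) (corresponds_map hs h5 hΨ a)

end Side

/-! ### Recovering the sides from the complex of cuts -/

namespace Side

variable {B : Type*} [BooleanAlgebra B]

/-- The cut with the given side. -/
def cut (a : Side B) : CutVertex B :=
  ⟨s(a.1, a.1ᶜ), ⟨a.1, rfl⟩, by
    intro x hx
    rcases Sym2.mem_iff.1 hx with rfl | rfl
    exacts [a.2.1, a.2.2]⟩

theorem cut_compl (a : Side B) : aᶜ.cut = a.cut :=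
  Subtype.ext <| by
    change s(a.1ᶜ, a.1ᶜᶜ) = s(a.1, a.1ᶜ)
    rw [_root_.compl_compl, Sym2.eq_swap]

theorem exists_cut_eq (v : CutVertex B) : ∃ a : Side B, a.cut = v := by
  obtain ⟨v, ⟨a, rfl⟩, hv⟩ := v
  exact ⟨⟨a, hv a (by simp), hv _ (by simp)⟩, rfl⟩

theorem cut_eq_iff {a b : Side B} : a.cut = b.cut ↔ a = b ∨ a = bᶜ := by
  constructor
  · intro h
    have : a.1 ∈ b.cut.1 := h ▸ Sym2.mem_mk_left _ _
    rcases Sym2.mem_iff.1 this with h | h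
    exacts [Or.inl (Side.ext h), Or.inr (Side.ext h)]
  · rintro (rfl | rfl)
    exacts [rfl, cut_compl b]

theorem not_le_compl_of_le {a b c : Side B} (h : c ≤ a) (h' : c ≤ b) : ¬ a ≤ bᶜ := by
  intro hab
  have h1 : c.1 ≤ b.1ᶜ := (h.trans hab : c ≤ bᶜ)
  exact c.2.1.1 (disjoint_self.1 ((le_compl_iff_disjoint_right.1 h1).mono_right h'))

theorem not_le_compl_self (a : Side B) : ¬ a ≤ aᶜ := not_le_compl_of_le le_rfl le_rfl

theorem le_compl_comm {a b : Side B} : a ≤ bᶜ ↔ b ≤ aᶜ :=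
  le_compl_iff_le_compl (a := a.1) (b := b.1)

theorem compl_le_comm {a b : Side B} : aᶜ ≤ b ↔ bᶜ ≤ a :=
  compl_le_iff_compl_le (x := a.1) (y := b.1)

theorem compl_le_compl_iff {a b : Side B} : aᶜ ≤ bᶜ ↔ b ≤ a :=
  _root_.compl_le_compl_iff_le (x := b.1) (y := a.1)

theorem lt_compl_comm {a b : Side B} : a < bᶜ ↔ b < aᶜ := by
  rw [lt_iff_le_not_ge, lt_iff_le_not_ge, le_compl_comm, compl_le_comm]

theorem crosses_cut_iff {a b : Side B} : Crosses a.cut.1 b.cut.1 ↔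
    ¬ a ≤ bᶜ ∧ ¬ a ≤ b ∧ ¬ b ≤ a ∧ ¬ aᶜ ≤ b := by
  have h1 : a ≤ b ↔ a.1 ⊓ b.1ᶜ = ⊥ := by
    rw [← val_compl, inf_eq_bot_iff, compl_compl]
  have h2 : b ≤ a ↔ a.1ᶜ ⊓ b.1 = ⊥ := by
    rw [← val_compl, inf_eq_bot_iff, compl_le_compl_iff]
  have h3 : aᶜ ≤ b ↔ a.1ᶜ ⊓ b.1ᶜ = ⊥ := by
    rw [← val_compl, ← val_compl, inf_eq_bot_iff, compl_compl]
  rw [h1, h2, h3, ← inf_eq_bot_iff]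
  change (∀ x ∈ s(a.1, a.1ᶜ), ∀ y ∈ s(b.1, b.1ᶜ), x ⊓ y ≠ ⊥) ↔ _
  simp only [Sym2.mem_iff, forall_eq_or_imp, forall_eq]
  tauto

theorem crosses_of_le {a x p q r t : B} (hp : p ≠ ⊥) (hq : q ≠ ⊥) (hr : r ≠ ⊥) (ht : t ≠ ⊥)
    (h1 : p ≤ a ⊓ x) (h2 : q ≤ a ⊓ xᶜ) (h3 : r ≤ aᶜ ⊓ x) (h4 : t ≤ aᶜ ⊓ xᶜ) :
    Crosses s(a, aᶜ) s(x, xᶜ) := by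
  simp only [Crosses, Sym2.mem_iff, forall_eq_or_imp, forall_eq]
  exact ⟨⟨ne_bot_of_le_ne_bot hp h1, ne_bot_of_le_ne_bot hq h2⟩,
    ne_bot_of_le_ne_bot hr h3, ne_bot_of_le_ne_bot ht h4⟩

theorem adj_cut_iff {a b : Side B} : (cutComplex B).Adj a.cut b.cut ↔
    (a < b ∨ aᶜ < b) ∨ (a < bᶜ ∨ aᶜ < bᶜ) := by
  change a.cut ≠ b.cut ∧ ¬ Crosses a.cut.1 b.cut.1 ↔ _
  rw [ne_eq, cut_eq_iff, crosses_cut_iff]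
  simp only [lt_iff_le_and_ne, ne_eq, compl_le_compl_iff]
  have h1 : aᶜ = b ↔ a = bᶜ := ⟨fun h => by rw [← h, compl_compl], fun h => by rw [h, compl_compl]⟩
  have h2 : aᶜ = bᶜ ↔ a = b := ⟨fun h => by rw [← compl_compl a, h, compl_compl], fun h => by rw [h]⟩
  rw [h1, h2]
  have h3 : ∀ x : Side B, ¬ xᶜ ≤ x := fun x h => not_le_compl_self xᶜ (by rwa [compl_compl])
  have h4 := not_le_compl_self (B := B)
  by_cases hab : a = b
  · subst hab
    have := h3 a
    have := h4 a
    tauto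
  · by_cases hab' : a = bᶜ
    · subst hab'
      have := h3 b
      have := h4 b
      rw [compl_compl]
      tauto
    · tauto

/-- The cut has a side properly contained in `a`. -/
def _root_.CutVertex.Inside (v : CutVertex B) (a : Side B) : Prop := ∃ x : Side B, x.cut = v ∧ x < a

theorem inside_cut_iff {a b : Side B} : a.cut.Inside b ↔ a < b ∨ aᶜ < b := by
  constructor
  · rintro ⟨x, hx, hxb⟩
    rcases cut_eq_iff.1 hx with rfl | rfl
    exacts [Or.inl hxb, Or.inr hxb]
  · rintro (h | h)
    exacts [⟨a, rfl, h⟩, ⟨aᶜ, cut_compl a, h⟩]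

theorem adj_cut_iff_inside {v : CutVertex B} {b : Side B} : (cutComplex B).Adj v b.cut ↔
    v.Inside b ∨ v.Inside bᶜ := by
  obtain ⟨a, rfl⟩ := exists_cut_eq v
  rw [adj_cut_iff, inside_cut_iff, inside_cut_iff]

theorem not_inside_compl {v : CutVertex B} {b : Side B} (h : v.Inside b) : ¬ v.Inside bᶜ := by
  rintro ⟨y, rfl, hy⟩
  obtain ⟨x, hx, hxb⟩ := h
  rcases cut_eq_iff.1 hx with rfl | rfl
  · exact not_le_compl_of_le hy.le hxb.le le_rfl
  · exact hy.not_ge (compl_le_comm.1 hxb.le)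

theorem inside_compl_iff {v : CutVertex B} {b : Side B} (h : (cutComplex B).Adj v b.cut) :
    v.Inside bᶜ ↔ ¬ v.Inside b :=
  ⟨fun h1 h2 => not_inside_compl h2 h1, fun h1 => (adj_cut_iff_inside.1 h).resolve_left h1⟩

/-- One condition alone leaves the orientation of one cut open: the first allows `aᶜ < b`. The two
together fix both orientations, and both concern only on which side of a cut a neighbour lies. -/
theorem lt_iff_inside {a b : Side B} : a < b ↔ a.cut.Inside b ∧ b.cut.Inside aᶜ := by
  rw [inside_cut_iff, inside_cut_iff]
  constructor
  · intro h
    exact ⟨Or.inl h, Or.inr (lt_compl_comm.2 (by rwa [compl_compl]))⟩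
  · rintro ⟨h1 | h1, h2⟩
    · exact h1
    · exfalso
      rcases h2 with h2 | h2
      · exact h2.not_ge h1.le
      · rw [lt_compl_comm, compl_compl] at h2
        exact not_le_compl_of_le (c := bᶜ) (a := bᶜ) (b := bᶜ) le_rfl le_rfl
          (by rw [compl_compl]; exact (compl_le_comm.1 h1.le).trans h2.le)

/-! ### Telling the sides of a cut apart within the graph -/

/-- Two cuts cross, in terms of the graph. -/
def GraphCross (u v : CutVertex B) : Prop := u ≠ v ∧ ¬ (cutComplex B).Adj u v

theorem graphCross_iff {u v : CutVertex B} : GraphCross u v ↔ Crosses u.1 v.1 := by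
  obtain ⟨a, rfl⟩ := exists_cut_eq u
  obtain ⟨b, rfl⟩ := exists_cut_eq v
  change a.cut ≠ b.cut ∧ ¬ (a.cut ≠ b.cut ∧ ¬ Crosses a.cut.1 b.cut.1) ↔ _
  rw [crosses_cut_iff, ne_eq, cut_eq_iff]
  constructor
  · tauto
  · intro h
    refine ⟨?_, by tauto⟩
    rintro (rfl | rfl)
    exacts [h.2.1 le_rfl, h.1 le_rfl]

/-- Two neighbours of a cut `w` lie on the same side of it, in terms of the graph. -/
def GraphSameSide (w u v : CutVertex B) : Prop :=
  GraphCross u v ∨ ∃ x, (cutComplex B).Adj x w ∧ GraphCross u x ∧ GraphCross v x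

theorem not_graphCross {a : Side B} {u v : CutVertex B} (hu : u.Inside a) (hv : v.Inside aᶜ) :
    ¬ GraphCross u v := by
  obtain ⟨x, rfl, hx⟩ := hu
  obtain ⟨y, rfl, hy⟩ := hv
  rw [graphCross_iff, crosses_cut_iff]
  exact fun h => h.1 (hx.le.trans (le_compl_comm.1 hy.le))

/-- Cuts inside opposite sides never cross. A neighbour `x` of `a.cut` is itself inside `a` or `aᶜ`,
so it cannot cross the one of `u`, `v` on the other side. -/
theorem not_graphSameSide {a : Side B} {u v : CutVertex B} (hu : u.Inside a) (hv : v.Inside aᶜ) :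
    ¬ GraphSameSide a.cut u v := by
  rintro (h | ⟨x, hx, h1, h2⟩)
  · exact not_graphCross hu hv h
  · rcases adj_cut_iff_inside.1 hx with h | h
    · rw [GraphCross, ne_comm, SimpleGraph.adj_comm] at h2
      exact not_graphCross h hv h2
    · exact not_graphCross hu h h1

theorem graphSameSide {a : Side B} {u v : CutVertex B} (hu : u.Inside a) (hv : v.Inside a) :
    GraphSameSide a.cut u v := by
  by_cases huv : GraphCross u v
  · exact Or.inl huv
  refine Or.inr ?_
  have main : ∀ x : B, IsThick x → x < a.1 → ∃ y, (cutComplex B).Adj y a.cut ∧ y.1 = s(x, xᶜ) := by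
    intro x hx hxa
    let z : Side B := ⟨x, hx, a.2.2.mono (compl_le_compl hxa.le)⟩
    exact ⟨z.cut, adj_cut_iff_inside.2 (Or.inl ⟨z, rfl, hxa⟩), rfl⟩
  -- Join a part `p` of `b` to `a \ c`. This crosses both `b` and `c`; it stays strictly below `a`
  -- because it misses the rest `q` of `b`, and `aᶜ` fills the fourth corner.
  have nested : ∀ b c : Side B, b ≤ c → c < a →
      ∃ x, (cutComplex B).Adj x a.cut ∧ GraphCross b.cut x ∧ GraphCross c.cut x := by
    intro b c hbc hca
    obtain ⟨p, q, hp, hq, hpq, hb⟩ := b.2.1.exists_split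
    have hbc' : b.1 ≤ c.1 := hbc
    have hca' : c.1 < a.1 := hca
    have hpb : p ≤ b.1 := hb ▸ le_sup_left
    have hqb : q ≤ b.1 := hb ▸ le_sup_right
    have hr : a.1 \ c.1 ≠ ⊥ := fun h => hca'.not_ge (sdiff_eq_bot_iff.1 h)
    have hrc : a.1 \ c.1 ≤ c.1ᶜ := by rw [sdiff_eq]; exact inf_le_right
    have hqx : q ≤ (p ⊔ a.1 \ c.1)ᶜ := by
      rw [compl_sup]
      exact le_inf (le_compl_iff_disjoint_left.2 (disjoint_iff.2 hpq))
        ((hqb.trans hbc').trans (_root_.le_compl_comm.1 hrc))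
    have hxa : p ⊔ a.1 \ c.1 ≤ a.1 := sup_le ((hpb.trans hbc').trans hca'.le) sdiff_le
    have hax := compl_le_compl hxa
    have hac := compl_le_compl hca'.le
    have hcb := compl_le_compl hbc'
    obtain ⟨y, hy, hyx⟩ := main (p ⊔ a.1 \ c.1)
      (IsThick.sup hp hr (le_bot_iff.1 ((inf_le_inf (hpb.trans hbc') hrc).trans (by simp))))
      (hxa.lt_of_ne fun h => hq (disjoint_self.1
        ((le_compl_iff_disjoint_right.1 hqx).mono_right
          (((hqb.trans hbc').trans hca'.le).trans h.ge))))
    refine ⟨y, hy, ?_, ?_⟩ <;> rw [graphCross_iff, hyx]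
    · exact crosses_of_le hp hq hr a.2.2.1 (le_inf hpb le_sup_left) (le_inf hqb hqx)
        (le_inf (hrc.trans hcb) le_sup_right) (le_inf (hac.trans hcb) hax)
    · exact crosses_of_le hp hq hr a.2.2.1 (le_inf (hpb.trans hbc') le_sup_left)
        (le_inf (hqb.trans hbc') hqx) (le_inf hrc le_sup_right) (le_inf hac hax)
  obtain ⟨b, rfl, hb⟩ := hu
  obtain ⟨c, rfl, hc⟩ := hv
  rw [graphCross_iff, crosses_cut_iff] at huv
  -- Both `b` and `c` lie below `a`, so they cannot cover everything; non-crossing leaves only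
  -- nested or disjoint.
  have h4 : ¬ bᶜ ≤ c := by
    intro h
    exact not_le_compl_of_le (a := aᶜ) (b := aᶜ) le_rfl le_rfl
      (by rw [compl_compl]; exact ((compl_le_compl_iff.2 hb.le).trans h).trans hc.le)
  by_cases h2 : b ≤ c
  · exact nested b c h2 hc
  by_cases h3 : c ≤ b
  · obtain ⟨x, h, h', h''⟩ := nested c b h3 hb
    exact ⟨x, h, h'', h'⟩
  have h1 : b ≤ cᶜ := by tauto
  have h1' : b.1 ≤ c.1ᶜ := h1
  have hca : c.1 ≤ a.1 := hc.le
  have hba : b.1 ≤ a.1 := hb.le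
  obtain ⟨p, q, hp, hq, hpq, hbe⟩ := b.2.1.exists_split
  obtain ⟨r, t, hr, ht, hrt, hce⟩ := c.2.1.exists_split
  have hpb : p ≤ b.1 := hbe ▸ le_sup_left
  have hqb : q ≤ b.1 := hbe ▸ le_sup_right
  have hrc : r ≤ c.1 := hce ▸ le_sup_left
  have htc : t ≤ c.1 := hce ▸ le_sup_right
  have h1'' : c.1 ≤ b.1ᶜ := _root_.le_compl_comm.1 h1'
  have hqx : q ≤ (p ⊔ r)ᶜ := by
    rw [compl_sup]
    exact le_inf (le_compl_iff_disjoint_left.2 (disjoint_iff.2 hpq))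
      ((hqb.trans h1').trans (compl_le_compl hrc))
  have htx : t ≤ (p ⊔ r)ᶜ := by
    rw [compl_sup]
    exact le_inf ((htc.trans h1'').trans (compl_le_compl hpb))
      (le_compl_iff_disjoint_left.2 (disjoint_iff.2 hrt))
  have hxa : p ⊔ r ≤ a.1 := sup_le (hpb.trans hba) (hrc.trans hca)
  -- For disjoint `b` and `c`, a part of each gives a common crossing cut.
  obtain ⟨y, hy, hyx⟩ := main (p ⊔ r)
    (IsThick.sup hp hr (le_bot_iff.1 ((inf_le_inf hpb (hrc.trans h1'')).trans (by simp))))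
    (hxa.lt_of_ne fun h => hq (disjoint_self.1
      ((le_compl_iff_disjoint_right.1 hqx).mono_right ((hqb.trans hba).trans h.ge))))
  refine ⟨y, hy, ?_, ?_⟩ <;> rw [graphCross_iff, hyx]
  · exact crosses_of_le hp hq hr ht (le_inf hpb le_sup_left) (le_inf hqb hqx)
      (le_inf (hrc.trans h1'') le_sup_right) (le_inf (htc.trans h1'') htx)
  · exact crosses_of_le hr ht hp hq (le_inf hrc le_sup_right) (le_inf htc htx)
      (le_inf (hpb.trans h1') le_sup_left) (le_inf (hqb.trans h1') hqx)

theorem graphSameSide_iff {a : Side B} {u v : CutVertex B} (hu : (cutComplex B).Adj u a.cut)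
    (hv : (cutComplex B).Adj v a.cut) :
    GraphSameSide a.cut u v ↔ (u.Inside a ↔ v.Inside a) := by
  by_cases h1 : u.Inside a <;> by_cases h2 : v.Inside a
  · simpa [h1, h2] using graphSameSide h1 h2
  · simpa [h1, h2] using not_graphSameSide h1 ((inside_compl_iff hv).2 h2)
  · have := not_graphSameSide (a := aᶜ) (u := u) (v := v) ((inside_compl_iff hu).2 h1)
      (by rwa [compl_compl])
    rw [cut_compl] at this
    simpa [h1, h2] using this
  · have := graphSameSide ((inside_compl_iff hu).2 h1) ((inside_compl_iff hv).2 h2)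
    rw [cut_compl] at this
    simpa [h1, h2] using this

/-! ### Lifting a graph automorphism to the sides -/

theorem graphCross_map_iff (ψ : cutComplex B ≃g cutComplex B) {u v : CutVertex B} :
    GraphCross (ψ u) (ψ v) ↔ GraphCross u v := by
  simp only [GraphCross, SimpleGraph.Iso.map_adj_iff, ψ.injective.ne_iff]

theorem graphSameSide_map_iff (ψ : cutComplex B ≃g cutComplex B) {w u v : CutVertex B} :
    GraphSameSide (ψ w) (ψ u) (ψ v) ↔ GraphSameSide w u v := by
  rw [GraphSameSide, GraphSameSide, graphCross_map_iff, ψ.surjective.exists]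
  refine or_congr_right (exists_congr fun x => ?_)
  rw [graphCross_map_iff, graphCross_map_iff, ψ.map_adj_iff]

/-- The side `a'` is the image of the side `a` under a graph automorphism. -/
def IsImage (ψ : cutComplex B ≃g cutComplex B) (a a' : Side B) : Prop :=
  a'.cut = ψ a.cut ∧
    ∀ u : CutVertex B, (cutComplex B).Adj u a.cut → (u.Inside a ↔ (ψ u).Inside a')

theorem IsImage.symm {ψ : cutComplex B ≃g cutComplex B} {a a' : Side B} (h : IsImage ψ a a') :
    IsImage ψ.symm a' a := by
  refine ⟨by rw [h.1]; exact (ψ.symm_apply_apply _).symm, fun u hu => ?_⟩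
  have := h.2 (ψ.symm u) (by
    rw [← ψ.map_adj_iff, ← h.1]; rwa [show ψ (ψ.symm u) = u from ψ.apply_symm_apply u])
  rw [show ψ (ψ.symm u) = u from ψ.apply_symm_apply u] at this
  exact this.symm

theorem IsImage.adj {ψ : cutComplex B ≃g cutComplex B} {a a' : Side B} (h : IsImage ψ a a')
    {u : CutVertex B} (hu : (cutComplex B).Adj u a.cut) : (cutComplex B).Adj (ψ u) a'.cut := by
  rw [h.1, ψ.map_adj_iff]
  exact hu

theorem IsImage.compl {ψ : cutComplex B ≃g cutComplex B} {a a' : Side B} (h : IsImage ψ a a') :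
    IsImage ψ aᶜ a'ᶜ := by
  refine ⟨by rw [cut_compl, cut_compl, h.1], fun u hu => ?_⟩
  rw [cut_compl] at hu
  rw [inside_compl_iff hu, inside_compl_iff (h.adj hu), h.2 u hu]

theorem IsImage.lt {ψ : cutComplex B ≃g cutComplex B} {a a' b b' : Side B} (ha : IsImage ψ a a')
    (hb : IsImage ψ b b') (h : a < b) : a' < b' := by
  have hadj : (cutComplex B).Adj a.cut b.cut := adj_cut_iff.2 (Or.inl (Or.inl h))
  rw [lt_iff_inside] at h ⊢
  rw [ha.1, hb.1]
  refine ⟨(hb.2 _ hadj).1 h.1, (ha.compl.2 _ ?_).1 h.2⟩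
  rw [cut_compl]
  exact hadj.symm

theorem exists_adj_cut {s : B → ℕ∞} (hs : IsPointCount s) (h5 : 5 ≤ s ⊤) (a : Side B) :
    ∃ u, (cutComplex B).Adj u a.cut := by
  obtain ⟨b, hb⟩ := hs.exists_side_lt h5 a
  exact ⟨b.cut, adj_cut_iff.2 (hb.imp Or.inl Or.inl)⟩

/-- A single neighbour `u` selects which side of `ψ a.cut` is the image. Every other neighbour then
agrees, because being on the same side as `u` is a graph property. -/
theorem exists_isImage {s : B → ℕ∞} (hs : IsPointCount s) (h5 : 5 ≤ s ⊤)
    (ψ : cutComplex B ≃g cutComplex B) (a : Side B) : ∃ a', IsImage ψ a a' := by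
  obtain ⟨u, hu⟩ := exists_adj_cut hs h5 a
  obtain ⟨c, hc⟩ := exists_cut_eq (ψ a.cut)
  have hu' : (cutComplex B).Adj (ψ u) c.cut := by rwa [hc, ψ.map_adj_iff]
  have : ∃ a' : Side B, a'.cut = ψ a.cut ∧ (u.Inside a ↔ (ψ u).Inside a') := by
    by_cases h : u.Inside a ↔ (ψ u).Inside c
    · exact ⟨c, hc, h⟩
    · refine ⟨cᶜ, by rw [cut_compl, hc], ?_⟩
      rw [inside_compl_iff hu']
      tauto
  obtain ⟨a', ha', h⟩ := this
  refine ⟨a', ha', fun v hv => ?_⟩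
  have h1 := graphSameSide_iff hu hv
  have h2 := graphSameSide_iff (a := a') (u := ψ u) (v := ψ v) (by rwa [ha', ψ.map_adj_iff])
    (by rwa [ha', ψ.map_adj_iff])
  rw [ha', graphSameSide_map_iff] at h2
  tauto

theorem IsImage.unique {s : B → ℕ∞} (hs : IsPointCount s) (h5 : 5 ≤ s ⊤)
    {ψ : cutComplex B ≃g cutComplex B} {a b c : Side B} (hb : IsImage ψ a b)
    (hc : IsImage ψ a c) : b = c := by
  obtain ⟨u, hu⟩ := exists_adj_cut hs h5 a
  rcases cut_eq_iff.1 (hb.1.trans hc.1.symm) with h | h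
  · exact h
  · exfalso
    have h1 := hb.2 u hu
    rw [h, inside_compl_iff (hc.adj hu), ← hc.2 u hu] at h1
    tauto

/-- Graph automorphisms of the complex of cuts come from automorphisms of the set of sides. -/
theorem exists_lift {s : B → ℕ∞} (hs : IsPointCount s) (h5 : 5 ≤ s ⊤)
    (ψ : cutComplex B ≃g cutComplex B) :
    ∃ Ψ : Side B ≃o Side B, (∀ a, Ψ aᶜ = (Ψ a)ᶜ) ∧ ∀ a, (Ψ a).cut = ψ a.cut := by
  choose f hf using exists_isImage hs h5 ψ
  choose g hg using exists_isImage hs h5 ψ.symm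
  have h1 : Function.LeftInverse g f := fun a => (hg (f a)).unique hs h5 (hf a).symm
  have h2 : Function.RightInverse g f := fun a => (hf (g a)).unique hs h5 (hg a).symm
  have hfm : ∀ a b, a < b → f a < f b := fun a b h => (hf a).lt (hf b) h
  have hgm : ∀ a b, a < b → g a < g b := fun a b h => (hg a).lt (hg b) h
  refine ⟨{ toFun := f, invFun := g, left_inv := h1, right_inv := h2, map_rel_iff' := ?_ },
    fun a => (hf aᶜ).unique hs h5 (hf a).compl, fun a => (hf a).1⟩
  intro a b
  constructor
  · intro h
    have := StrictMono.monotone hgm h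
    rwa [Equiv.coe_fn_mk, h1, h1] at this
  · exact fun h => StrictMono.monotone hfm h

end Side

/-! ### Isomorphisms of topological groups -/

namespace IsTopGroupIso

variable {G H K : Type*} [Group G] [TopologicalSpace G] [Group H] [TopologicalSpace H]
  [Group K] [TopologicalSpace K]

theorem of_isInducing {f : G →* H} (hf : Function.Bijective f) (h : Topology.IsInducing f) :
    IsTopGroupIso f :=
  ⟨{ MulEquiv.ofBijective f hf with
      continuous_toFun := h.continuous
      continuous_invFun := h.continuous_iff.2 <| by
        have : f ∘ (MulEquiv.ofBijective f hf).symm = id :=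
          funext fun x => (MulEquiv.ofBijective f hf).apply_symm_apply x
        exact this ▸ continuous_id }, fun _ => rfl⟩

theorem comp {g : H →* K} {f : G →* H} (hg : IsTopGroupIso g) (hf : IsTopGroupIso f) :
    IsTopGroupIso (g.comp f) := by
  obtain ⟨e, he⟩ := hg
  obtain ⟨e', he'⟩ := hf
  exact ⟨e'.trans e, fun x => by simp [← he, ← he']⟩

theorem of_comp {g : H →* K} {f : G →* H} (hg : IsTopGroupIso g)
    (h : IsTopGroupIso (g.comp f)) : IsTopGroupIso f := by
  obtain ⟨e, he⟩ := hg
  obtain ⟨e', he'⟩ := h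
  refine ⟨e'.trans e.symm, fun x => ?_⟩
  change e.symm (e' x) = f x
  rw [he', MonoidHom.comp_apply, ← he, e.symm_apply_apply]

end IsTopGroupIso

/-! ### The action of automorphisms on the complex of cuts -/

section CutAction

variable {B : Type*} [BooleanAlgebra B] {s : B → ℕ∞}

theorem mapCut_cut (φ : B ≃o B) (a b : Side B) (h : φ a.1 = b.1) : mapCut φ a.cut = b.cut :=
  Subtype.ext <| by
    change Sym2.map φ s(a.1, a.1ᶜ) = s(b.1, b.1ᶜ)
    rw [Sym2.map_mk]
    simp [h]

theorem mapCut_cut_eq_iff (φ : B ≃o B) (a : Side B) :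
    mapCut φ a.cut = a.cut ↔ φ a.1 = a.1 ∨ φ a.1 = a.1ᶜ := by
  let b : Side B := ⟨φ a.1, by
    constructor
    · exact ⟨by simpa using a.2.1.1, by simpa using a.2.1.2⟩
    · rw [← map_compl]
      exact ⟨by simpa using a.2.2.1, by simpa using a.2.2.2⟩⟩
  rw [mapCut_cut φ a b rfl, Side.cut_eq_iff, Side.ext_iff, Side.ext_iff]
  rfl

/-- If `φ` exchanged the sides of `a.cut`, then `φ b`, which is `b` or `bᶜ`, would lie below `aᶜ`.
Either case is incompatible with `b < a`. -/
theorem apply_eq_of_mapCut_eq {φ : B ≃o B} {a b : Side B} (hb : b < a)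
    (h1 : mapCut φ a.cut = a.cut) (h2 : mapCut φ b.cut = b.cut) : φ a.1 = a.1 := by
  rw [mapCut_cut_eq_iff] at h1 h2
  refine h1.resolve_right fun h => ?_
  have hb' : φ b.1 ≤ φ a.1 := φ.monotone hb.le
  rw [h] at hb'
  rcases h2 with h2 | h2 <;> rw [h2] at hb'
  · exact Side.not_le_compl_of_le le_rfl hb.le (hb' : b ≤ aᶜ)
  · exact hb.not_ge (Side.compl_le_compl_iff.1 (hb' : bᶜ ≤ aᶜ))

theorem exists_finset_side (hs : IsPointCount s) (h5 : 5 ≤ s ⊤) (a : Side B) :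
    ∃ F : Finset (CutVertex B), ∀ φ : B ≃o B, (∀ v ∈ F, mapCut φ v = v) → φ a.1 = a.1 := by
  classical
  obtain ⟨b, hb | hb⟩ := hs.exists_side_lt h5 a
  · exact ⟨{a.cut, b.cut}, fun φ h => apply_eq_of_mapCut_eq hb (h _ (by simp)) (h _ (by simp))⟩
  · refine ⟨{aᶜ.cut, b.cut}, fun φ h => ?_⟩
    have := apply_eq_of_mapCut_eq hb (h _ (by simp)) (h _ (by simp))
    rwa [Side.val_compl, map_compl, compl_inj_iff] at this

/-- Each element is fixed by the automorphisms that fix a suitable finite set of cuts. -/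
theorem exists_finset_apply_eq (hs : IsPointCount s) (h5 : 5 ≤ s ⊤) (x : B) :
    ∃ F : Finset (CutVertex B), ∀ φ : B ≃o B, (∀ v ∈ F, mapCut φ v = v) → φ x = x := by
  classical
  obtain ⟨c, d, e, f, rfl⟩ := hs.exists_sides_eq h5 x
  choose F hF using exists_finset_side hs h5
  refine ⟨F c ∪ F d ∪ F e ∪ F f, fun φ h => ?_⟩
  rw [map_sup, map_inf, map_inf, hF c φ fun v hv => h v (by simp [hv]),
    hF d φ fun v hv => h v (by simp [hv]), hF e φ fun v hv => h v (by simp [hv]),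
    hF f φ fun v hv => h v (by simp [hv])]

theorem autCutAction_injective (hs : IsPointCount s) (h5 : 5 ≤ s ⊤) :
    Function.Injective (autCutAction B) := by
  rw [injective_iff_map_eq_one]
  intro φ hφ
  refine RelIso.ext fun x => ?_
  obtain ⟨F, hF⟩ := exists_finset_apply_eq hs h5 x
  exact hF φ fun v _ => DFunLike.congr_fun hφ v

theorem autCutAction_surjective (hs : IsPointCount s) (h5 : 5 ≤ s ⊤) :
    Function.Surjective (autCutAction B) := by
  intro ψ
  obtain ⟨Ψ, h1, h2⟩ := Side.exists_lift hs h5 ψ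
  obtain ⟨φ, hφ⟩ := Side.exists_orderIso_extending hs h5 h1
  refine ⟨φ, RelIso.ext fun v => ?_⟩
  obtain ⟨a, rfl⟩ := Side.exists_cut_eq v
  exact (mapCut_cut φ a (Ψ a) (hφ a)).trans (h2 a)

theorem autCutAction_isInducing (hs : IsPointCount s) (h5 : 5 ≤ s ⊤) :
    Topology.IsInducing (autCutAction B) := by
  rw [IsTopologicalGroup.isInducing_iff_nhds_one]
  ext t
  rw [Filter.mem_comap, mem_nhds_one_iff_stabilizer]
  constructor
  · classical
    rintro ⟨F, hF⟩
    choose g hg using exists_finset_apply_eq hs h5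
    refine ⟨{ψ | ∀ v ∈ F.biUnion g, ψ v = v}, (mem_nhds_one_iff_stabilizer _).2 ⟨_, le_rfl⟩,
      fun φ hφ => hF fun x hx => hg x φ fun v hv => hφ v (Finset.mem_biUnion.2 ⟨x, hx, hv⟩)⟩
  · classical
    rintro ⟨u, hu, hut⟩
    obtain ⟨F, hF⟩ := (mem_nhds_one_iff_stabilizer _).1 hu
    choose a ha using Side.exists_cut_eq (B := B)
    refine ⟨F.image fun v => (a v).1, fun φ hφ => hut (hF fun v hv => ?_)⟩
    have h := mapCut_cut φ (a v) (a v) (hφ _ (Finset.mem_image_of_mem _ hv))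
    rwa [ha] at h

theorem isTopGroupIso_autCutAction (hs : IsPointCount s) (h5 : 5 ≤ s ⊤) :
    IsTopGroupIso (autCutAction B) :=
  .of_isInducing ⟨autCutAction_injective hs h5, autCutAction_surjective hs h5⟩
    (autCutAction_isInducing hs h5)

end CutAction

/-! ### The action of homeomorphisms on clopen sets -/

/-- Automorphisms of the algebra of clopen sets act on points. -/
theorem exists_point {E : Type*} [TopologicalSpace E] [CompactSpace E] (φ : Clopens E ≃o Clopens E) (x : E) :
    ∃ y : E, ∀ U : Clopens E, y ∈ φ U ↔ x ∈ U := by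
  -- The images of the clopen sets containing `x` form a directed family of nonempty compact closed
  -- sets. For the converse membership, the same family contains the image of `Uᶜ` when `x ∉ U`.
  have h : (⋂ U : {U : Clopens E // x ∈ U}, (φ U.1 : Set E)).Nonempty := by
    have : Nonempty {U : Clopens E // x ∈ U} := ⟨⟨⊤, trivial⟩⟩
    refine IsCompact.nonempty_iInter_of_directed_nonempty_isCompact_isClosed _ ?_ ?_ ?_ ?_
    · intro U V
      exact ⟨⟨U.1 ⊓ V.1, U.2, V.2⟩, φ.monotone inf_le_left, φ.monotone inf_le_right⟩
    · intro U
      by_contra h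
      rw [Set.not_nonempty_iff_eq_empty] at h
      have h' : φ U.1 = ⊥ := Clopens.ext h
      rw [map_eq_bot_iff] at h'
      have := U.2
      rw [h'] at this
      exact this
    · exact fun U => (φ U.1).isClosed.isCompact
    · exact fun U => (φ U.1).isClosed
  obtain ⟨y, hy⟩ := h
  rw [Set.mem_iInter] at hy
  refine ⟨y, fun U => ⟨fun h => ?_, fun h => hy ⟨U, h⟩⟩⟩
  by_contra hx
  have := hy ⟨Uᶜ, hx⟩
  rw [map_compl] at this
  exact this h

section Clopen

variable {E : Type*} [TopologicalSpace E] [CompactSpace E] [T2Space E] [TotallyDisconnectedSpace E]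

theorem exists_clopens_mem_notMem {x y : E} (h : x ≠ y) : ∃ U : Clopens E, x ∈ U ∧ y ∉ U := by
  obtain ⟨V, hV, hx, hy⟩ := exists_isClopen_of_totally_separated h
  exact ⟨⟨V, hV⟩, hx, hy⟩

theorem eq_of_forall_mem_clopens {x y : E} (h : ∀ U : Clopens E, x ∈ U → y ∈ U) : x = y := by
  by_contra hxy
  obtain ⟨U, hx, hy⟩ := exists_clopens_mem_notMem hxy
  exact hy (h U hx)

theorem clopenAction_injective : Function.Injective (clopenAction E) := by
  rw [injective_iff_map_eq_one]
  intro f hf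
  refine Homeomorph.ext fun x => ?_
  refine (eq_of_forall_mem_clopens fun U hU => ?_).symm
  have h : imageClopen f U = U := DFunLike.congr_fun hf U
  have h' : f x ∈ imageClopen f U := ⟨x, hU, rfl⟩
  rwa [h] at h'

theorem clopenAction_surjective : Function.Surjective (clopenAction E) := by
  intro φ
  choose f hf using exists_point φ
  choose g hg using exists_point φ.symm
  have hgf : Function.LeftInverse g f := fun x =>
    (eq_of_forall_mem_clopens fun U hU => by
      have := hg (f x) (φ U)
      rw [φ.symm_apply_apply] at this
      rwa [this, hf]).symm
  have hfg : Function.RightInverse g f := fun x =>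
    (eq_of_forall_mem_clopens fun U hU => by
      have := hf (g x) (φ.symm U)
      rw [φ.apply_symm_apply] at this
      rwa [this, hg]).symm
  have cont : ∀ (φ : Clopens E ≃o Clopens E) (f : E → E), (∀ x U, f x ∈ φ U ↔ x ∈ U) →
      Continuous f := by
    intro φ f hf
    refine (isTopologicalBasis_isClopen (X := E)).continuous_iff.2 fun V hV => ?_
    have : f ⁻¹' V = (φ.symm ⟨V, hV⟩ : Clopens E) := by
      ext x
      have := hf x (φ.symm ⟨V, hV⟩)
      rwa [φ.apply_symm_apply] at this
    rw [this]
    exact Clopens.isOpen _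
  refine ⟨{ toFun := f, invFun := g, left_inv := hgf, right_inv := hfg,
            continuous_toFun := cont φ f hf, continuous_invFun := cont φ.symm g hg },
    RelIso.ext fun U => Clopens.ext (Set.ext fun y => ?_)⟩
  change y ∈ f '' U ↔ y ∈ φ U
  constructor
  · rintro ⟨x, hx, rfl⟩
    exact (hf x U).2 hx
  · intro hy
    refine ⟨g y, ?_, hfg y⟩
    rw [← hfg y, hf] at hy
    exact hy

theorem exists_isClopen_between {K W : Set E} (hK : IsCompact K) (hW : IsOpen W) (h : K ⊆ W) :
    ∃ V : Set E, IsClopen V ∧ K ⊆ V ∧ V ⊆ W := by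
  refine hK.induction_on (p := fun S => ∃ V : Set E, IsClopen V ∧ S ⊆ V ∧ V ⊆ W)
    ⟨∅, isClopen_empty, le_rfl, Set.empty_subset _⟩ ?_ ?_ ?_
  · rintro S T hST ⟨V, hV, h1, h2⟩
    exact ⟨V, hV, hST.trans h1, h2⟩
  · rintro S T ⟨V, hV, h1, h2⟩ ⟨V', hV', h1', h2'⟩
    exact ⟨V ∪ V', hV.union hV', Set.union_subset_union h1 h1', Set.union_subset h2 h2'⟩
  · intro x hx
    obtain ⟨V, hV, hxV, hVW⟩ := compact_exists_isClopen_in_isOpen hW (h hx)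
    exact ⟨V, mem_nhdsWithin_of_mem_nhds (hV.isOpen.mem_nhds hxV), V, hV, le_rfl, hVW⟩

theorem clopenAction_isInducing : Topology.IsInducing (clopenAction E) := by
  refine ⟨le_antisymm ?_ ?_⟩
  · rw [← continuous_iff_le_induced, permutationTopology_continuous_iff]
    intro U V
    -- For a bijection, `f(U) = V` means that `f` maps `U` into `V` and `Uᶜ` into `Vᶜ`; both are
    -- compact-open conditions, as clopen sets are compact and open.
    have : {f : E ≃ₜ E | clopenAction E f U = V} =
        (fun f : E ≃ₜ E => (⟨f, f.continuous⟩ : C(E, E))) ⁻¹'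
          ({f | Set.MapsTo f (U : Set E) V} ∩ {f | Set.MapsTo f (U : Set E)ᶜ (V : Set E)ᶜ}) := by
      ext f
      change imageClopen f U = V ↔
        Set.MapsTo f (U : Set E) V ∧ Set.MapsTo f (U : Set E)ᶜ (V : Set E)ᶜ
      constructor
      · rintro rfl
        refine ⟨fun x hx => ⟨x, hx, rfl⟩, ?_⟩
        rintro x hx ⟨y, hy, hyx⟩
        exact hx (f.injective hyx ▸ hy)
      · rintro ⟨h1, h2⟩
        refine Clopens.ext (Set.Subset.antisymm (Set.mapsTo_iff_image_subset.1 h1) fun y hy => ?_)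
        refine ⟨f.symm y, ?_, f.apply_symm_apply y⟩
        by_contra h
        exact h2 h (by rwa [f.apply_symm_apply])
    rw [this]
    exact ((ContinuousMap.isOpen_setOfPred_mapsTo U.isClosed.isCompact V.isOpen).inter
      (ContinuousMap.isOpen_setOfPred_mapsTo (Uᶜ).isClosed.isCompact (Vᶜ).isOpen)).preimage
      continuous_induced_dom
  · let _ : TopologicalSpace (E ≃ₜ E) := .induced (clopenAction E) inferInstance
    have hc : Continuous (clopenAction E) := continuous_induced_dom
    change _ ≤ TopologicalSpace.induced _ _
    rw [← continuous_iff_le_induced, ContinuousMap.continuous_compactOpen]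
    intro K hK W hW
    rw [isOpen_iff_mem_nhds]
    intro f hf
    have hf' : f '' K ⊆ W := Set.mapsTo_iff_image_subset.1 hf
    -- With a clopen `V` between `f(K)` and `W`, every `g` that agrees with `f` on the single clopen
    -- set `f ⁻¹' V` also maps `K` into `W`.
    obtain ⟨V, hV, hKV, hVW⟩ :=
      exists_isClopen_between (hK.image f.continuous) hW hf'
    let U : Clopens E := ⟨f ⁻¹' V, hV.preimage f.continuous⟩
    refine Filter.mem_of_superset
      ((permutationTopology_isOpen U (clopenAction E f U)).preimage hc |>.mem_nhds rfl) ?_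
    intro g hg x hx
    have hg' : imageClopen g U = imageClopen f U := hg
    have hxU : x ∈ U := hKV ⟨x, hx, rfl⟩
    have h1 : g x ∈ imageClopen f U := hg' ▸ ⟨x, hxU, rfl⟩
    obtain ⟨y, hy, hyx⟩ := h1
    change g x ∈ W
    rw [← hyx]
    exact hVW hy

theorem isTopGroupIso_clopenAction : IsTopGroupIso (clopenAction E) :=
  .of_isInducing ⟨clopenAction_injective, clopenAction_surjective⟩ clopenAction_isInducing

end Clopen

/-! ### Stone duality -/

section Conjugation

variable {B C : Type*} [BooleanAlgebra B] [BooleanAlgebra C]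

/-- Conjugation by an order isomorphism. -/
def conjAut (e : B ≃o C) : (B ≃o B) →* (C ≃o C) where
  toFun φ := (e.symm.trans φ).trans e
  map_one' := RelIso.ext fun x => e.apply_symm_apply x
  map_mul' φ ψ := RelIso.ext fun x => by
    change e (φ (ψ (e.symm x))) = e (φ (e.symm (e (ψ (e.symm x)))))
    rw [e.symm_apply_apply]

theorem conjAut_conjAut_symm (e : B ≃o C) (φ : C ≃o C) : conjAut e (conjAut e.symm φ) = φ :=
  RelIso.ext fun x => by
    change e (e.symm (φ (e (e.symm x)))) = φ x
    simp

theorem continuous_conjAut (e : B ≃o C) : Continuous (conjAut e) := by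
  rw [permutationTopology_continuous_iff]
  intro x y
  have : {φ : B ≃o B | conjAut e φ x = y} = {φ : B ≃o B | φ (e.symm x) = e.symm y} := by
    ext φ
    exact (e.eq_symm_apply (x := φ (e.symm x)) (y := y)).symm
  rw [this]
  exact permutationTopology_isOpen _ _

theorem isTopGroupIso_conjAut (e : B ≃o C) : IsTopGroupIso (conjAut e) :=
  ⟨{ conjAut e with
      invFun := conjAut e.symm
      left_inv := conjAut_conjAut_symm e.symm
      right_inv := conjAut_conjAut_symm e
      continuous_toFun := continuous_conjAut e
      continuous_invFun := continuous_conjAut e.symm }, fun _ => rfl⟩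

end Conjugation

namespace StoneSpace

open Order

variable {B : Type*} [BooleanAlgebra B]

theorem coe_ne_univ_iff {F : PFilter B} : (F : Set B) ≠ Set.univ ↔ ⊥ ∉ F := by
  rw [not_iff_comm, not_not, Set.eq_univ_iff_forall]
  exact ⟨fun h b => PFilter.mem_of_le bot_le h, fun h => h ⊥⟩

theorem maximal_of_mem_or_compl_mem {F : PFilter B} (h0 : ⊥ ∉ F) (h : ∀ a, a ∈ F ∨ aᶜ ∈ F) :
    Maximal (fun F : PFilter B => (F : Set B) ≠ Set.univ) F := by
  refine ⟨coe_ne_univ_iff.2 h0, fun G hG hFG a ha => ?_⟩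
  refine (h a).resolve_right fun h' => ?_
  have := PFilter.inf_mem ha (hFG h')
  rw [inf_compl_eq_bot] at this
  exact coe_ne_univ_iff.1 hG this

/-- The prime ideal theorem separates `F` from the zero ideal; the complement of the prime ideal is
the desired filter. -/
theorem exists_le {F : PFilter B} (h : ⊥ ∉ F) :
    ∃ G : PFilter B, F ≤ G ∧ ⊥ ∉ G ∧ ∀ a, a ∈ G ∨ aᶜ ∈ G := by
  obtain ⟨J, hJ, -, hFJ⟩ := DistribLattice.prime_ideal_of_disjoint_filter_ideal
    (F := F) (I := Ideal.principal (⊥ : B)) <| by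
      rw [Set.disjoint_left]
      intro x hx hx'
      exact h (le_bot_iff.1 (hx' : x ≤ ⊥) ▸ hx)
  have hmem : ∀ a, a ∈ hJ.toPrimePair.F ↔ a ∉ J := fun a => Iff.rfl
  refine ⟨hJ.toPrimePair.F, fun a ha => Set.disjoint_left.1 hFJ ha, ?_, fun a => ?_⟩
  · rw [hmem, not_not]
    exact J.bot_mem
  · rw [hmem, hmem, ← not_and_or]
    rintro ⟨h1, h2⟩
    have := Ideal.sup_mem h1 h2
    rw [sup_compl_eq_top] at this
    exact hJ.toIsProper.top_notMem this

theorem bot_notMem (ω : StoneSpace B) : ⊥ ∉ ω.1 := coe_ne_univ_iff.1 ω.2.1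

theorem compl_mem_iff (ω : StoneSpace B) {a : B} : aᶜ ∈ ω.1 ↔ a ∉ ω.1 := by
  constructor
  · intro h1 h2
    have := PFilter.inf_mem h2 h1
    rw [inf_compl_eq_bot] at this
    exact ω.bot_notMem this
  · obtain ⟨G, hG, h0, h⟩ := exists_le ω.bot_notMem
    have := ω.2.2 (coe_ne_univ_iff.2 h0) hG
    exact fun h' => this ((h a).resolve_left fun h2 => h' (this h2))

theorem exists_mem {a : B} (ha : a ≠ ⊥) : ∃ ω : StoneSpace B, a ∈ ω.1 := by
  obtain ⟨G, hG, h0, h⟩ := exists_le (F := PFilter.principal a)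
    fun h => ha (le_bot_iff.1 (PFilter.mem_principal.1 h))
  exact ⟨⟨G, maximal_of_mem_or_compl_mem h0 h⟩, hG (PFilter.mem_principal.2 le_rfl)⟩

/-- The set of ultrafilters that contain `b`. -/
def basicSet (b : B) : Set (StoneSpace B) := {ω | b ∈ ω.1}

theorem isOpen_basicSet (b : B) : IsOpen (basicSet b) :=
  isOpen_generateFrom_of_mem ⟨b, rfl⟩

theorem compl_basicSet (b : B) : (basicSet b)ᶜ = basicSet bᶜ :=
  Set.ext fun ω => ω.compl_mem_iff.symm

theorem basicSet_inf (a b : B) : basicSet (a ⊓ b) = basicSet a ∩ basicSet b :=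
  Set.ext fun _ => PFilter.inf_mem_iff

theorem isClopen_basicSet (b : B) : IsClopen (basicSet b) :=
  ⟨by rw [← isOpen_compl_iff, compl_basicSet]; exact isOpen_basicSet _, isOpen_basicSet b⟩

theorem basicSet_subset_iff {a b : B} : basicSet a ⊆ basicSet b ↔ a ≤ b := by
  constructor
  · intro h
    by_contra hab
    obtain ⟨ω, hω⟩ := exists_mem (a := a ⊓ bᶜ) fun h' =>
      hab (by rwa [← disjoint_iff, disjoint_compl_right_iff] at h')
    have := PFilter.inf_mem_iff.1 hω
    exact ω.compl_mem_iff.1 this.2 (h this.1)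
  · exact fun h ω hω => PFilter.mem_of_le h hω

theorem isTopologicalBasis_basicSet :
    IsTopologicalBasis (Set.range (basicSet : B → Set (StoneSpace B))) where
  exists_subset_inter := by
    rintro _ ⟨a, rfl⟩ _ ⟨b, rfl⟩ ω hω
    exact ⟨_, ⟨a ⊓ b, rfl⟩, by rwa [basicSet_inf], (basicSet_inf a b).le⟩
  sUnion_eq := Set.eq_univ_of_forall fun ω => ⟨_, ⟨⊤, rfl⟩, PFilter.top_mem⟩
  eq_generateFrom := rfl

instance : TotallySeparatedSpace (StoneSpace B) := by
  rw [totallySeparatedSpace_iff_exists_isClopen]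
  intro ω ω' h
  by_contra! h'
  have hle : ω.1 ≤ ω'.1 := by
    intro b hb
    by_contra hb'
    exact h' (basicSet b) (isClopen_basicSet b) hb hb'
  exact h (Subtype.ext (hle.antisymm (ω.2.2 ω'.2.1 hle)))

instance : CompactSpace (StoneSpace B) := by
  refine ⟨isCompact_iff_ultrafilter_le_nhds.2 fun 𝒰 _ => ?_⟩
  -- The limit of `𝒰` is the ultrafilter on `B` of those `b` whose basic set is `𝒰`-large.
  have hF : IsPFilter {b : B | basicSet b ∈ 𝒰} := by
    refine IsPFilter.of_def ⟨⊤, ?_⟩ ?_ ?_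
    · exact Filter.mem_of_superset Filter.univ_mem fun ω _ => PFilter.top_mem
    · intro a ha b hb
      refine ⟨a ⊓ b, ?_, inf_le_left, inf_le_right⟩
      change basicSet (a ⊓ b) ∈ 𝒰
      rw [basicSet_inf]
      exact Filter.inter_mem ha hb
    · exact fun {a b} hab ha => Filter.mem_of_superset ha (basicSet_subset_iff.2 hab)
  have hmem : ∀ b, b ∈ hF.toPFilter ↔ basicSet b ∈ 𝒰 := fun b => Iff.rfl
  have hmax := maximal_of_mem_or_compl_mem (F := hF.toPFilter) ?_ fun a => ?_
  · let ω : StoneSpace B := ⟨hF.toPFilter, hmax⟩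
    refine ⟨ω, trivial, ?_⟩
    change _ ≤ @nhds _ (generateFrom _) ω
    rw [nhds_generateFrom]
    refine le_iInf₂ fun S hS => ?_
    obtain ⟨h, b, rfl⟩ := hS
    exact Filter.le_principal_iff.2 h
  · rw [hmem]
    have : basicSet (⊥ : B) = ∅ := Set.eq_empty_of_forall_notMem fun ω => ω.bot_notMem
    rw [this]
    exact 𝒰.empty_notMem
  · rw [hmem, hmem, ← compl_basicSet]
    exact 𝒰.mem_or_compl_mem _

theorem exists_basicSet_eq (U : Clopens (StoneSpace B)) :
    ∃ b : B, basicSet b = (U : Set (StoneSpace B)) := by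
  obtain ⟨b, h1, h2⟩ := U.isClosed.isCompact.induction_on
    (p := fun S => ∃ b : B, S ⊆ basicSet b ∧ basicSet b ⊆ (U : Set (StoneSpace B)))
    ⟨⊥, Set.empty_subset _, fun ω hω => absurd hω ω.bot_notMem⟩
    (by
      rintro S T hST ⟨b, h1, h2⟩
      exact ⟨b, hST.trans h1, h2⟩)
    (by
      rintro S T ⟨b, h1, h2⟩ ⟨b', h1', h2'⟩
      refine ⟨b ⊔ b', Set.union_subset (h1.trans (basicSet_subset_iff.2 le_sup_left))
        (h1'.trans (basicSet_subset_iff.2 le_sup_right)), ?_⟩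
      refine Set.Subset.trans (fun ω hω => ?_) (Set.union_subset h2 h2')
      by_contra h
      rw [Set.mem_union, not_or] at h
      have h3 := PFilter.inf_mem (ω.compl_mem_iff.2 h.1) (ω.compl_mem_iff.2 h.2)
      rw [← compl_sup, compl_mem_iff] at h3
      exact h3 hω)
    (by
      intro ω hω
      obtain ⟨_, ⟨b, rfl⟩, h1, h2⟩ := isTopologicalBasis_basicSet.mem_nhds_iff.1
        (U.isOpen.mem_nhds hω)
      exact ⟨basicSet b, mem_nhdsWithin_of_mem_nhds ((isOpen_basicSet b).mem_nhds h1),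
        b, le_rfl, h2⟩)
  exact ⟨b, h2.antisymm h1⟩

/-- A Boolean algebra is the algebra of clopen sets of its Stone space. -/
noncomputable def clopensIso (B : Type*) [BooleanAlgebra B] : B ≃o Clopens (StoneSpace B) :=
  RelIso.ofSurjective
    (OrderEmbedding.ofMapLEIff (fun b : B => (⟨basicSet b, isClopen_basicSet b⟩ : Clopens _))
      fun _ _ => basicSet_subset_iff)
    fun U => (exists_basicSet_eq U).imp fun _ h => Clopens.ext h

theorem clopenAction_comp_stoneAction :
    (clopenAction (StoneSpace B)).comp (stoneAction B) = conjAut (clopensIso B) := by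
  refine MonoidHom.ext fun φ => RelIso.ext fun U => ?_
  obtain ⟨b, rfl⟩ := (clopensIso B).surjective U
  change imageClopen (stoneAction B φ) (clopensIso B b) =
    clopensIso B (φ ((clopensIso B).symm (clopensIso B b)))
  rw [OrderIso.symm_apply_apply]
  refine Clopens.ext (Set.ext fun ω => ?_)
  change ω ∈ mapUltrafilter φ '' basicSet b ↔ φ b ∈ ω.1
  constructor
  · rintro ⟨ω, hω, rfl⟩
    exact ⟨b, hω, rfl⟩
  · intro h
    exact ⟨mapUltrafilter φ.symm ω, ⟨φ b, h, by simp⟩, Subtype.ext (mapFilter_symm φ ω.1)⟩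

/-- Followed by the action on clopen sets, this map is conjugation by `clopensIso`. Two of the three
maps are isomorphisms, hence so is the third. -/
theorem isTopGroupIso_stoneAction (B : Type*) [BooleanAlgebra B] : IsTopGroupIso (stoneAction B) :=
  isTopGroupIso_clopenAction.of_comp
    (clopenAction_comp_stoneAction (B := B) ▸ isTopGroupIso_conjAut _)

end StoneSpace

/-! ### Counting points -/

theorem isPointCount_encard (E : Type*) [TopologicalSpace E] [CompactSpace E] [T2Space E]
    [TotallyDisconnectedSpace E] : IsPointCount fun U : Clopens E => (U : Set E).encard where
  sup U V h := Set.encard_union_eq (Clopens.coe_disjoint.2 (disjoint_iff.2 h))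
  eq_zero U := by
    rw [Set.encard_eq_zero]
    exact (SetLike.coe_injective.eq_iff (b := (⊥ : Clopens E)))
  eq_one U := by
    constructor
    · intro h
      obtain ⟨x, hx⟩ := Set.encard_eq_one.1 h
      refine ⟨?_, fun V hV => ?_⟩
      · rintro rfl
        exact Set.singleton_ne_empty x hx.symm
      · have h1 : (V : Set E) ⊂ {x} := hx ▸ SetLike.coe_ssubset_coe.2 hV
        exact Clopens.ext (Set.ssubset_singleton_iff.1 h1)
    · intro h
      -- The degenerate pair `s(U, U)` turns the criterion for cuts into one for the single set `U`.
      have h1 : ¬ (U : Set E).Nontrivial := fun h' =>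
        ((isNonperipheral_clopens_iff s(U, U)).2 (by simpa using h') U (by simp)).2 h
      rw [← Set.one_lt_encard_iff_nontrivial, not_lt] at h1
      refine h1.antisymm (Set.one_le_encard_iff_nonempty.2 ?_)
      by_contra h2
      exact h.1 (Clopens.ext (Set.not_nonempty_iff_eq_empty.1 h2))

theorem IsPointCount.comp {B C : Type*} [BooleanAlgebra B] [BooleanAlgebra C] {s : C → ℕ∞}
    (hs : IsPointCount s) (e : B ≃o C) : IsPointCount fun b => s (e b) where
  sup a b h := by
    rw [map_sup]
    exact hs.sup _ _ (by rw [← map_inf, h, map_bot])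
  eq_zero a := by rw [hs.eq_zero, map_eq_bot_iff]
  eq_one a := by rw [hs.eq_one, e.isAtom_iff]

/-! ### Distances in the complex of cuts -/

section Diameter

variable {B : Type*} [BooleanAlgebra B] {s : B → ℕ∞}

/-- The thick corner is a side lying properly inside both `a` and `b`, so its cut is a common
neighbour. -/
theorem edist_cut_le_two_of_isThick {a b : Side B} (h : Crosses a.cut.1 b.cut.1)
    (ht : IsThick (a.1 ⊓ b.1)) : (cutComplex B).edist a.cut b.cut ≤ 2 := by
  rw [Side.crosses_cut_iff] at h
  let c : Side B := ⟨a.1 ⊓ b.1, ht, a.2.2.mono (compl_le_compl inf_le_left)⟩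
  have hca : c ≤ a := (inf_le_left : a.1 ⊓ b.1 ≤ a.1)
  have hcb : c ≤ b := (inf_le_right : a.1 ⊓ b.1 ≤ b.1)
  have h1 : c < a := hca.lt_of_ne fun h' => h.2.1 (h' ▸ hcb)
  have h2 : c < b := hcb.lt_of_ne fun h' => h.2.2.1 (h' ▸ hca)
  exact ((SimpleGraph.Walk.nil (u := b.cut)).cons
    (Side.adj_cut_iff.2 (Or.inl (Or.inl h2))) |>.cons
    (Side.adj_cut_iff.2 (Or.inl (Or.inl h1))).symm).edist_le

theorem edist_le_two (hs : IsPointCount s) (h5 : 5 ≤ s ⊤) (u v : CutVertex B) :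
    (cutComplex B).edist u v ≤ 2 := by
  by_cases huv : u = v
  · simp [huv]
  by_cases hadj : (cutComplex B).Adj u v
  · rw [SimpleGraph.edist_eq_one_iff_adj.2 hadj]
    norm_num
  have h := Side.graphCross_iff.1 ⟨huv, hadj⟩
  obtain ⟨a, rfl⟩ := Side.exists_cut_eq u
  obtain ⟨b, rfl⟩ := Side.exists_cut_eq v
  rcases hs.exists_isThick_corner h5 a.1 b.1 with ht | ht | ht | ht
  · exact edist_cut_le_two_of_isThick h ht
  · rw [← b.cut_compl] at h ⊢
    exact edist_cut_le_two_of_isThick h ht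
  · rw [← a.cut_compl] at h ⊢
    exact edist_cut_le_two_of_isThick h ht
  · rw [← a.cut_compl, ← b.cut_compl] at h ⊢
    exact edist_cut_le_two_of_isThick h ht

theorem ediam_cutComplex_le_two (hs : IsPointCount s) (h5 : 5 ≤ s ⊤) :
    (cutComplex B).ediam ≤ 2 :=
  SimpleGraph.ediam_le_of_edist_le (edist_le_two hs h5)

/-- Split the top into two thick halves and each half into two pieces; regrouping one piece from
each half crosses the first cut. -/
theorem exists_crosses (hs : IsPointCount s) (h4 : 4 ≤ s ⊤) :
    ∃ u v : CutVertex B, Crosses u.1 v.1 := by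
  obtain ⟨b, c, hb, hc, hbc, -⟩ := hs.exists_isThick_split h4
  obtain ⟨p, q, hp, hq, hpq, hbe⟩ := hb.exists_split
  obtain ⟨r, t, hr, ht, hrt, hce⟩ := hc.exists_split
  have hpb : p ≤ b := hbe ▸ le_sup_left
  have hqb : q ≤ b := hbe ▸ le_sup_right
  have hrc : r ≤ c := hce ▸ le_sup_left
  have htc : t ≤ c := hce ▸ le_sup_right
  have disj {x y : B} (hx : x ≤ b) (hy : y ≤ c) : x ⊓ y = ⊥ :=
    le_bot_iff.1 ((inf_le_inf hx hy).trans hbc.le)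
  have lec {x y : B} (h : x ⊓ y = ⊥) : x ≤ yᶜ := le_compl_iff_disjoint_right.2 (disjoint_iff.2 h)
  have hcb : c ≤ bᶜ := lec (by rwa [inf_comm])
  have hqx : q ≤ (p ⊔ r)ᶜ := by
    rw [compl_sup]
    exact le_inf (lec (by rwa [inf_comm])) (lec (disj hqb hrc))
  have htx : t ≤ (p ⊔ r)ᶜ := by
    rw [compl_sup]
    exact le_inf (lec (by rw [inf_comm]; exact disj hpb htc)) (lec (by rwa [inf_comm]))
  let x : Side B := ⟨b, hb, hc.mono hcb⟩
  let y : Side B := ⟨p ⊔ r, IsThick.sup hp hr (disj hpb hrc),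
    (IsThick.sup hq ht (disj hqb htc)).mono (sup_le hqx htx)⟩
  exact ⟨x.cut, y.cut, Side.crosses_of_le hp hq hr ht (le_inf hpb le_sup_left) (le_inf hqb hqx)
    (le_inf (hrc.trans hcb) le_sup_right) (le_inf (htc.trans hcb) htx)⟩

theorem two_le_ediam_cutComplex (hs : IsPointCount s) (h4 : 4 ≤ s ⊤) :
    2 ≤ (cutComplex B).ediam := by
  obtain ⟨u, v, h⟩ := exists_crosses hs h4
  have h' := Side.graphCross_iff.2 h
  refine le_trans ?_ (SimpleGraph.edist_le_ediam (u := u) (v := v))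
  by_contra! h2
  have h3 : (cutComplex B).edist u v ≤ 1 := Order.le_of_lt_add_one (by rwa [one_add_one_eq_two])
  rcases SimpleGraph.edist_le_one_iff_adj_or_eq.1 h3 with h3 | h3
  exacts [h'.2 h3, h'.1 h3]

theorem nonempty_cutVertex (hs : IsPointCount s) (h5 : 5 ≤ s ⊤) : Nonempty (CutVertex B) :=
  (hs.nonempty_side h5).map Side.cut

theorem connected_cutComplex (hs : IsPointCount s) (h5 : 5 ≤ s ⊤) : (cutComplex B).Connected := by
  have := nonempty_cutVertex hs h5
  refine SimpleGraph.connected_of_ediam_ne_top fun h => ?_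
  have := ediam_cutComplex_le_two hs h5
  rw [h] at this
  exact absurd this (by decide)

/-- Each cut has two sides, and four sides determine an element through `exists_sides_eq`. -/
theorem finite_of_finite_cutVertex (hs : IsPointCount s) (h5 : 5 ≤ s ⊤) [Finite (CutVertex B)] :
    Finite B := by
  have : Finite (Side B) := by
    choose g hg using Side.exists_cut_eq (B := B)
    refine Finite.of_surjective
      (fun x : CutVertex B × Bool => if x.2 then g x.1 else (g x.1)ᶜ) fun a => ?_
    rcases Side.cut_eq_iff.1 (hg a.cut).symm with h | h
    · exact ⟨(a.cut, true), by simpa using h.symm⟩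
    · exact ⟨(a.cut, false), by simpa using h.symm⟩
  refine Finite.of_surjective (fun x : (Side B × Side B) × Side B × Side B =>
    (x.1.1.1 ⊓ x.1.2.1) ⊔ (x.2.1.1 ⊓ x.2.2.1)) fun x => ?_
  obtain ⟨c, d, e, f, h⟩ := hs.exists_sides_eq h5 x
  exact ⟨((c, d), e, f), h⟩

end Diameter

theorem mainTheorem1 :
    (∀ (E : Type*) [TopologicalSpace E] [CompactSpace E] [T2Space E] [TotallyDisconnectedSpace E]
        [SecondCountableTopology E], 5 ≤ ENat.card E →
      IsTopGroupIso (homeoCutAction E) ∧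
      IsTopGroupIso (clopenAction E) ∧
      (cutComplex (Clopens E)).Connected ∧
      (Finite E → Finite (CutVertex (Clopens E)) ∧ (cutComplex (Clopens E)).ediam ≤ 4) ∧
      (Infinite E → Countable (CutVertex (Clopens E)) ∧ Infinite (CutVertex (Clopens E)) ∧
        (cutComplex (Clopens E)).ediam = 2)) ∧
    (∀ (B : Type*) [BooleanAlgebra B] [Countable B], 5 ≤ ENat.card (StoneSpace B) →
      IsTopGroupIso (autCutAction B) ∧
      IsTopGroupIso (stoneAction B)) := by
  refine ⟨fun E _ _ _ _ _ h => ?_, fun B _ _ h => ?_⟩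
  · have hs := isPointCount_encard E
    have h5 : 5 ≤ ((⊤ : Clopens E) : Set E).encard := by
      rwa [Clopens.coe_top, Set.encard_univ]
    refine ⟨(isTopGroupIso_autCutAction hs h5).comp isTopGroupIso_clopenAction,
      isTopGroupIso_clopenAction, connected_cutComplex hs h5, fun hE => ⟨?_, ?_⟩,
      fun hE => ⟨?_, ?_, ?_⟩⟩
    · have : Finite (Clopens E) := Finite.of_injective _ SetLike.coe_injective
      have : Finite (Sym2 (Clopens E)) := Quot.finite _
      exact Subtype.finite
    · exact (ediam_cutComplex_le_two hs h5).trans (by norm_num)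
    · have : Countable (Clopens E) := Clopens.countable_iff_secondCountable.2 inferInstance
      have : Countable (Sym2 (Clopens E)) := Quotient.countable
      exact Subtype.countable
    · by_contra hfin
      rw [not_infinite_iff_finite] at hfin
      have := finite_of_finite_cutVertex hs h5
      -- A point is determined by the clopen sets containing it, so finitely many clopen sets allow
      -- only finitely many points.
      refine hE.not_finite (Finite.of_injective (fun x : E => {U : Clopens E | x ∈ U}) ?_)
      intro x y hxy
      exact eq_of_forall_mem_clopens fun U hU => (Set.ext_iff.1 hxy U).1 hU
    · exact (ediam_cutComplex_le_two hs h5).antisymm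
        (two_le_ediam_cutComplex hs (le_trans (by norm_num) h5))
  · have hs := (isPointCount_encard (StoneSpace B)).comp (StoneSpace.clopensIso B)
    refine ⟨isTopGroupIso_autCutAction hs ?_, StoneSpace.isTopGroupIso_stoneAction B⟩
    rwa [map_top, Clopens.coe_top, Set.encard_univ]
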